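/- Let $G$ be a simple graph, finite or infinite and not necessarily connected, whose vertex degrees are bounded by some finite number $D$, and let $\theta\in\mathbb{R}$. For a vertex $v$ of $G$, let $T(G,v)$ be the path tree of $G$ relative to $v$: its vertices are the finite (self-avoiding) paths of $G$ that start at $v$, and two such paths are adjacent if one is obtained from the other by adding one edge at its end. Let $A$ be the adjacency operator of $T(G,v)$, a bounded self-adjoint operator on the $\ell^2$ space over the vertices of $T(G,v)$, and let $\chi_v$ be the characteristic vector of the one-vertex path $v$. The matching measure $\nu_{G,v}$ is the spectral measure of $A$ at $\chi_v$, i.e. the unique probability measure on $[-D,D]$ with $\int x^n\,d\nu_{G,v}(x)=\langle A^n\chi_v,\chi_v\rangle$ for all $n\ge 0$. For a vertex $u$, let $G-u$ be the graph obtained by deleting $u$. The vertex $u$ is called - essential if $\nu_{G,u}(\{\theta\})>0$; - neutral if it is not essential and $\sum_{v\sim u}\nu_{G-u,v}(\{\theta\})=0$; - positive if $\sum_{v\sim u}\nu_{G-u,v}(\{\theta\})>0$. Then for every vertex $u$ of $G$ the following hold, all sums being absolutely convergent. 1. If $u$ is positive, then $\displaystyle\sum_{v\ne u}\bigl(\nu_{G-u,v}(\{\theta\})-\nu_{G,v}(\{\theta\})\bigr)=1$.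 2. If $u$ is neutral, then $\displaystyle\sum_{v\ne u}\bigl(\nu_{G-u,v}(\{\theta\})-\nu_{G,v}(\{\theta\})\bigr)=0$. 3. If $u$ is essential, then $\displaystyle\sum_{v\in V(G)}\bigl(\nu_{G-u,v}(\{\theta\})-\nu_{G,v}(\{\theta\})\bigr)=-1$, with the convention $\nu_{G-u,u}(\{\theta\})=0$. -/

import Mathlib

namespace MatchingMeasure

open scoped InnerProductSpace ENNReal CompactlySupported

/-! ### Graphs of bounded degree -/

/-- A graph has bounded degree if some natural number `D` bounds all its degrees. -/
class BoundedDegree {V : Type*} (G : SimpleGraph V) : Prop where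
  exists_bound : ∃ D : ℕ, ∀ v, (G.neighborSet v).encard ≤ D

theorem finite_neighborSet {V : Type*} (G : SimpleGraph V) [hG : BoundedDegree G] (v : V) :
    (G.neighborSet v).Finite := by
  obtain ⟨D, hD⟩ := hG.exists_bound
  exact Set.finite_of_encard_le_coe (hD v)

/-- The neighbours of `v`, as a finite set. -/
noncomputable def nbrs {V : Type*} (G : SimpleGraph V) [BoundedDegree G] (v : V) : Finset V :=
  (finite_neighborSet G v).toFinset

@[simp] theorem mem_nbrs {V : Type*} (G : SimpleGraph V) [BoundedDegree G] (v w : V) :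
    w ∈ nbrs G v ↔ G.Adj v w := by
  simp [nbrs]

theorem card_nbrs_le {V : Type*} (G : SimpleGraph V) [BoundedDegree G] {D : ℕ}
    (hD : ∀ v, (G.neighborSet v).encard ≤ D) (v : V) : (nbrs G v).card ≤ D := by
  have h := hD v
  rw [(finite_neighborSet G v).encard_eq_coe_toFinset_card] at h
  exact_mod_cast h

/-- `G - u`: the graph obtained from `G` by deleting the vertex `u`. -/
abbrev deleteVertex {V : Type*} (G : SimpleGraph V) (u : V) :
    SimpleGraph ({u}ᶜ : Set V) :=
  G.induce {u}ᶜ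

theorem encard_neighborSet_deleteVertex_le {V : Type*} (G : SimpleGraph V) (u : V)
    (v : ({u}ᶜ : Set V)) :
    ((deleteVertex G u).neighborSet v).encard ≤ (G.neighborSet v).encard :=
  Set.encard_le_encard_of_injOn (f := Subtype.val) (fun _ h => h)
    Subtype.val_injective.injOn

instance {V : Type*} (G : SimpleGraph V) [hG : BoundedDegree G] (u : V) :
    BoundedDegree (deleteVertex G u) := by
  obtain ⟨D, hD⟩ := hG.exists_bound
  exact ⟨D, fun v => (encard_neighborSet_deleteVertex_le G u v).trans (hD _)⟩

/-! ### The path tree -/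

/-- `𝒫(u)`: the finite paths in `G` which start at `u`, a path being stored with its last
vertex. -/
abbrev PathsFrom {V : Type*} (G : SimpleGraph V) (u : V) : Type _ :=
  Σ v : V, G.Path u v

/-- `P` is a maximal proper initial subpath of `Q`: `Q` is `P` with one more edge at its end. -/
def IsExtension {V : Type*} {G : SimpleGraph V} {u : V} (P Q : PathsFrom G u) : Prop :=
  ∃ h : G.Adj P.1 Q.1, Q.2.1 = P.2.1.concat h

/-- The path tree `T(G, u)`: two paths are adjacent when one is the other with one more edge. -/
def pathTree {V : Type*} (G : SimpleGraph V) (u : V) : SimpleGraph (PathsFrom G u) where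
  Adj P Q := IsExtension P Q ∨ IsExtension Q P
  symm := ⟨fun _ _ h => h.symm⟩
  loopless := ⟨fun P h => by
    rcases h with ⟨h, -⟩ | ⟨h, -⟩ <;> exact G.loopless.irrefl _ h⟩

theorem encard_neighborSet_pathTree_le {V : Type*} (G : SimpleGraph V) (u : V)
    (P : PathsFrom G u) :
    ((pathTree G u).neighborSet P).encard ≤ (G.neighborSet P.1).encard := by
  refine Set.encard_le_encard_of_injOn (f := Sigma.fst) ?_ ?_
  · rintro Q (⟨h, -⟩ | ⟨h, -⟩)
    exacts [h, h.symm]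
  · have key : ∀ Q R : PathsFrom G u, IsExtension P Q → IsExtension R P → Q.1 ≠ R.1 := by
      rintro ⟨a, Q⟩ ⟨b, R⟩ ⟨h, hQ⟩ ⟨h', hR⟩ hab
      obtain ⟨p, P⟩ := P
      dsimp only at h h' hQ hR hab
      subst hab
      have hn := Q.2.support_nodup
      rw [hQ, SimpleGraph.Walk.support_concat, hR, SimpleGraph.Walk.support_concat] at hn
      have := R.1.end_mem_support
      rw [List.append_assoc, List.nodup_append] at hn
      exact hn.2.2 a this a (by simp) rfl
    rintro ⟨a, Q⟩ hQ ⟨b, R⟩ hR hab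
    rcases hQ with hQ | hQ <;> rcases hR with hR | hR
    · obtain ⟨h, hQ⟩ := hQ
      obtain ⟨h', hR⟩ := hR
      dsimp only at h h' hQ hR hab
      subst hab
      rw [Subtype.ext (hQ.trans hR.symm)]
    · exact absurd hab (key _ _ hQ hR)
    · exact absurd hab.symm (key _ _ hR hQ)
    · obtain ⟨h, hQ⟩ := hQ
      obtain ⟨h', hR⟩ := hR
      obtain ⟨hv, hp⟩ := SimpleGraph.Walk.concat_inj (hQ.symm.trans hR)
      dsimp only at hv hp
      subst hv
      congr 1
      exact Subtype.ext hp

instance {V : Type*} (G : SimpleGraph V) [hG : BoundedDegree G] (u : V) :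
    BoundedDegree (pathTree G u) := by
  obtain ⟨D, hD⟩ := hG.exists_bound
  exact ⟨D, fun P => (encard_neighborSet_pathTree_le G u P).trans (hD _)⟩

/-! ### The adjacency operator -/

/-- The complex Hilbert space `ℓ²(X)`. -/
abbrev L2 (X : Type*) : Type _ := lp (fun _ : X => ℂ) 2

theorem sum_norm_sum_nbrs_le {X : Type*} (T : SimpleGraph X) [BoundedDegree T] {D : ℕ}
    (hD : ∀ v, (T.neighborSet v).encard ≤ D) (f : L2 X) (s : Finset X) :
    ∑ x ∈ s, ‖∑ y ∈ nbrs T x, f y‖ ^ 2 ≤ (D * ‖f‖) ^ 2 := by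
  classical
  have h1 : ∀ x, ‖∑ y ∈ nbrs T x, f y‖ ^ 2 ≤ D * ∑ y ∈ nbrs T x, ‖f y‖ ^ 2 := fun x =>
    calc ‖∑ y ∈ nbrs T x, f y‖ ^ 2 ≤ (∑ y ∈ nbrs T x, ‖f y‖) ^ 2 := by
          gcongr; exact norm_sum_le _ _
      _ ≤ (nbrs T x).card * ∑ y ∈ nbrs T x, ‖f y‖ ^ 2 := sq_sum_le_card_mul_sum_sq
      _ ≤ D * ∑ y ∈ nbrs T x, ‖f y‖ ^ 2 := by
          gcongr; exact card_nbrs_le T hD x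
  have h2 : ∑ x ∈ s, ∑ y ∈ nbrs T x, ‖f y‖ ^ 2 ≤
      ∑ y ∈ s.biUnion (nbrs T), D * ‖f y‖ ^ 2 := by
    rw [Finset.sum_comm' (t' := s.biUnion (nbrs T)) (s' := fun y => s.filter (T.Adj · y))]
    · refine Finset.sum_le_sum fun y _ => ?_
      rw [Finset.sum_const, nsmul_eq_mul]
      gcongr
      refine (Finset.card_le_card fun x hx => ?_).trans (card_nbrs_le T hD y)
      simpa using (Finset.mem_filter.1 hx).2.symm
    · intro x y
      simp only [mem_nbrs, Finset.mem_filter, Finset.mem_biUnion]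
      exact ⟨fun h => ⟨h, x, h⟩, fun h => h.1⟩
  have h3 : ∑ y ∈ s.biUnion (nbrs T), ‖f y‖ ^ 2 ≤ ‖f‖ ^ 2 := by
    have := lp.sum_rpow_le_norm_rpow (p := 2) (by simp) f (s.biUnion (nbrs T))
    simpa using this
  calc ∑ x ∈ s, ‖∑ y ∈ nbrs T x, f y‖ ^ 2
      ≤ ∑ x ∈ s, D * ∑ y ∈ nbrs T x, ‖f y‖ ^ 2 := Finset.sum_le_sum fun x _ => h1 x
    _ = D * ∑ x ∈ s, ∑ y ∈ nbrs T x, ‖f y‖ ^ 2 := by rw [Finset.mul_sum]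
    _ ≤ D * ∑ y ∈ s.biUnion (nbrs T), D * ‖f y‖ ^ 2 := by gcongr
    _ = D * (D * ∑ y ∈ s.biUnion (nbrs T), ‖f y‖ ^ 2) := by rw [← Finset.mul_sum]
    _ ≤ D * (D * ‖f‖ ^ 2) := by gcongr
    _ = (D * ‖f‖) ^ 2 := by ring

/-- The adjacency operator of `T` on `ℓ²(X)` as a linear map: `(A f)(x) = ∑_{y ∼ x} f(y)`. -/
noncomputable def adjLinear {X : Type*} (T : SimpleGraph X) [hT : BoundedDegree T] :
    L2 X →ₗ[ℂ] L2 X where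
  toFun f := ⟨fun x => ∑ y ∈ nbrs T x, f y, by
    obtain ⟨D, hD⟩ := hT.exists_bound
    refine memℓp_gen' (C := (D * ‖f‖) ^ 2) fun s => ?_
    simpa using sum_norm_sum_nbrs_le T hD f s⟩
  map_add' f g := by
    ext x
    exact Finset.sum_add_distrib
  map_smul' c f := by
    ext x
    simp [Finset.mul_sum]

theorem norm_adjLinear_le {X : Type*} (T : SimpleGraph X) [BoundedDegree T] {D : ℕ}
    (hD : ∀ v, (T.neighborSet v).encard ≤ D) (f : L2 X) :
    ‖adjLinear T f‖ ≤ D * ‖f‖ := by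
  refine lp.norm_le_of_forall_sum_le (by simp) (by positivity) fun s => ?_
  simpa using! sum_norm_sum_nbrs_le T hD f s

/-- The adjacency operator of a graph `T` of bounded degree, a bounded operator on `ℓ²(X)`. -/
noncomputable def adjOp {X : Type*} (T : SimpleGraph X) [hT : BoundedDegree T] :
    L2 X →L[ℂ] L2 X :=
  (adjLinear T).mkContinuousOfExistsBound <| by
    obtain ⟨D, hD⟩ := hT.exists_bound
    exact ⟨D, norm_adjLinear_le T hD⟩

@[simp] theorem adjOp_apply {X : Type*} (T : SimpleGraph X) [BoundedDegree T] (f : L2 X) (x : X) :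
    adjOp T f x = ∑ y ∈ nbrs T x, f y :=
  rfl

theorem norm_adjOp_le {X : Type*} (T : SimpleGraph X) [BoundedDegree T] {D : ℕ}
    (hD : ∀ v, (T.neighborSet v).encard ≤ D) : ‖adjOp T‖ ≤ D :=
  ContinuousLinearMap.opNorm_le_bound _ (by positivity) (norm_adjLinear_le T hD)

open scoped Classical in
/-- The characteristic vector of the point `x`. -/
noncomputable def chi {X : Type*} (x : X) : L2 X := lp.single 2 x (1 : ℂ)

theorem isSelfAdjoint_adjOp {X : Type*} (T : SimpleGraph X) [BoundedDegree T] :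
    IsSelfAdjoint (adjOp T) := by
  classical
  rw [ContinuousLinearMap.isSelfAdjoint_iff']
  refine lp.ext_continuousLinearMap (p := 2) (by simp) fun x => ?_
  ext y
  have h1 : ∀ g : L2 X, g y = ⟪lp.single 2 y (1 : ℂ), g⟫_ℂ := fun g => by
    simp [lp.inner_single_left]
  simp only [ContinuousLinearMap.comp_apply, lp.singleContinuousLinearMap_apply]
  rw [h1, ContinuousLinearMap.adjoint_inner_right, lp.inner_single_right, adjOp_apply,
    adjOp_apply]
  simp [lp.single_apply, Pi.single_apply, T.adj_comm]

/-! ### Spectral measures -/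

/-- The positive linear functional `f ↦ ⟨f(A) ξ, ξ⟩` on compactly supported continuous functions,
where `f(A)` is given by the continuous functional calculus of the self-adjoint operator `A`. -/
noncomputable def spectralFunctional {H : Type*} [NormedAddCommGroup H] [InnerProductSpace ℂ H]
    [CompleteSpace H] (A : H →L[ℂ] H) (ξ : H) : C_c(ℝ, ℝ) →ₚ[ℝ] ℝ :=
  PositiveLinearMap.mk₀
    { toFun := fun f => (⟪cfc (f : ℝ → ℝ) A ξ, ξ⟫_ℂ).re
      map_add' := fun f g => by
        have : cfc (⇑(f + g)) A = cfc (⇑f) A + cfc (⇑g) A :=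
          cfc_add (a := A) f g f.continuous.continuousOn g.continuous.continuousOn
        rw [this]
        simp
      map_smul' := fun c f => by
        have : cfc (⇑(c • f)) A = c • cfc (⇑f) A :=
          cfc_smul c f A f.continuous.continuousOn
        rw [this]
        simp }
    (fun f hf => by
      have h : 0 ≤ cfc (⇑f) A := cfc_nonneg fun x _ => hf x
      exact ((ContinuousLinearMap.nonneg_iff_isPositive _).1 h).re_inner_nonneg_left ξ)

/-- The spectral measure `E ↦ ⟨π(E) ξ, ξ⟩` of a bounded self-adjoint operator `A` at the vector
`ξ`, `π` being the projection valued measure of `A`: the Borel measure that represents the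
functional `f ↦ ⟨f(A) ξ, ξ⟩`. -/
noncomputable def spectralMeasure {H : Type*} [NormedAddCommGroup H] [InnerProductSpace ℂ H]
    [CompleteSpace H] (A : H →L[ℂ] H) (ξ : H) : MeasureTheory.Measure ℝ :=
  RealRMK.rieszMeasure (spectralFunctional A ξ)

theorem spectralMeasure_compl_spectrum {H : Type*} [NormedAddCommGroup H] [InnerProductSpace ℂ H]
    [CompleteSpace H] (A : H →L[ℂ] H) (ξ : H) : spectralMeasure A ξ (spectrum ℝ A)ᶜ = 0 := by
  have hK : IsCompact (spectrum ℝ A) := spectrum.isCompact A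
  have hreg : (spectralMeasure A ξ).Regular := RealRMK.regular_rieszMeasure _
  rw [hK.isClosed.isOpen_compl.measure_eq_iSup_isCompact]
  simp only [ENNReal.iSup_eq_zero]
  intro C hC' hC
  obtain ⟨g, hg1, hg0, hgc, hg⟩ := exists_continuous_one_zero_of_isCompact
    hC hK.isClosed (Set.disjoint_left.2 fun x hx hx' => hC' hx hx')
  have h := RealRMK.rieszMeasure_le_of_eq_one (spectralFunctional A ξ) (f := ⟨g, hgc⟩)
    (fun x => (hg x).1) hC (fun x hx => hg1 hx)
  have h0 : spectralFunctional A ξ ⟨g, hgc⟩ = 0 := by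
    change (⟪cfc (g : ℝ → ℝ) A ξ, ξ⟫_ℂ).re = 0
    rw [cfc_congr (g := fun _ => 0) (fun x hx => hg0 hx)]
    simp
  rw [h0, ENNReal.ofReal_zero] at h
  exact le_antisymm h bot_le

theorem integral_spectralMeasure {H : Type*} [NormedAddCommGroup H] [InnerProductSpace ℂ H]
    [CompleteSpace H] (A : H →L[ℂ] H) (ξ : H) {f : ℝ → ℝ} (hf : Continuous f) :
    ∫ x, f x ∂(spectralMeasure A ξ) = (⟪cfc f A ξ, ξ⟫_ℂ).re := by
  have hK : IsCompact (spectrum ℝ A) := spectrum.isCompact A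
  obtain ⟨g, hg1, -, hgc, hg⟩ := exists_continuous_one_zero_of_isCompact
    hK isClosed_empty (Set.disjoint_empty _)
  have h := RealRMK.integral_rieszMeasure (spectralFunctional A ξ)
    ⟨⟨fun x => f x * g x, hf.mul g.continuous⟩, hgc.mul_left⟩
  have hae : ∀ᵐ x ∂(spectralMeasure A ξ), f x = f x * g x := by
    refine MeasureTheory.measure_mono_null (t := (spectrum ℝ A)ᶜ) (fun x hx hxK => hx ?_)
      (spectralMeasure_compl_spectrum A ξ)
    simp [hg1 hxK]
  rw [MeasureTheory.integral_congr_ae hae]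
  refine h.trans ?_
  change (⟪cfc (fun x => f x * g x) A ξ, ξ⟫_ℂ).re = _
  rw [cfc_congr (g := f) (fun x hx => by simp [hg1 hx])]

theorem spectralMeasure_univ {H : Type*} [NormedAddCommGroup H] [InnerProductSpace ℂ H]
    [CompleteSpace H] {A : H →L[ℂ] H} (hA : IsSelfAdjoint A) (ξ : H) :
    spectralMeasure A ξ Set.univ = ENNReal.ofReal (‖ξ‖ ^ 2) := by
  have hK : IsCompact (spectrum ℝ A) := spectrum.isCompact A
  have hreg : (spectralMeasure A ξ).Regular := RealRMK.regular_rieszMeasure _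
  have hfin : spectralMeasure A ξ Set.univ ≠ ∞ := by
    rw [← Set.union_compl_self (spectrum ℝ A)]
    refine ((MeasureTheory.measure_union_le _ _).trans_lt ?_).ne
    rw [spectralMeasure_compl_spectrum, add_zero]
    exact hK.measure_lt_top
  have h := integral_spectralMeasure A ξ (f := fun _ => 1) continuous_const
  rw [cfc_const_one ℝ A] at h
  simp only [MeasureTheory.integral_const, smul_eq_mul, mul_one] at h
  rw [← ENNReal.ofReal_toReal hfin]
  congr 1
  refine h.trans ?_
  simp [inner_self_eq_norm_sq_to_K, ← Complex.ofReal_pow]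

theorem integral_pow_spectralMeasure {H : Type*} [NormedAddCommGroup H] [InnerProductSpace ℂ H]
    [CompleteSpace H] {A : H →L[ℂ] H} (hA : IsSelfAdjoint A) (ξ : H) (n : ℕ) :
    ((∫ x, x ^ n ∂(spectralMeasure A ξ) : ℝ) : ℂ) = ⟪(A ^ n) ξ, ξ⟫_ℂ := by
  rw [integral_spectralMeasure _ _ (continuous_pow n), cfc_pow_id (R := ℝ) A n hA]
  exact (hA.pow n).isSymmetric.coe_re_inner_apply_self _

/-! ### The matching measure -/

/-- The matching measure `ν_{G,u}`: the spectral measure of the adjacency operator of the path tree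
`T(G, u)` at the characteristic vector of the path consisting of the single vertex `u`. -/
noncomputable def matchingMeasure {V : Type*} (G : SimpleGraph V) [BoundedDegree G] (u : V) :
    MeasureTheory.Measure ℝ :=
  spectralMeasure (adjOp (pathTree G u)) (chi ⟨u, SimpleGraph.Path.nil⟩)

/-- The matching measure is a probability measure. -/
instance {V : Type*} (G : SimpleGraph V) [BoundedDegree G] (u : V) :
    MeasureTheory.IsProbabilityMeasure (matchingMeasure G u) := by
  classical
  refine ⟨(spectralMeasure_univ (isSelfAdjoint_adjOp _) _).trans ?_⟩
  simp [chi, lp.norm_single]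

/-- If all degrees are at most `D`, then the matching measure lives on `[-D, D]`. -/
theorem matchingMeasure_compl_Icc {V : Type*} (G : SimpleGraph V) [BoundedDegree G] (u : V)
    {D : ℕ} (hD : ∀ v, (G.neighborSet v).encard ≤ D) :
    matchingMeasure G u (Set.Icc (-D : ℝ) D)ᶜ = 0 := by
  refine MeasureTheory.measure_mono_null
    (t := (spectrum ℝ (adjOp (pathTree G u)))ᶜ) (fun x hx hxs => hx ?_)
    (spectralMeasure_compl_spectrum (adjOp (pathTree G u)) _)
  have h1 : ‖x‖ ≤ ‖adjOp (pathTree G u)‖ := by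
    have : Nontrivial (L2 (PathsFrom G u)) := ⟨⟨chi ⟨u, SimpleGraph.Path.nil⟩, 0, fun h => by
      simpa [chi] using congrArg (fun f : L2 (PathsFrom G u) =>
        f ⟨u, SimpleGraph.Path.nil⟩) h⟩⟩
    exact spectrum.norm_le_norm_of_mem hxs
  have h2 := h1.trans (norm_adjOp_le _ (D := D)
    fun P => (encard_neighborSet_pathTree_le G u P).trans (hD _))
  exact abs_le.1 h2

/-- The moments of the matching measure are `⟨Aⁿ χ_u, χ_u⟩`. -/
theorem integral_pow_matchingMeasure {V : Type*} (G : SimpleGraph V) [BoundedDegree G] (u : V)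
    (n : ℕ) :
    ((∫ x, x ^ n ∂(matchingMeasure G u) : ℝ) : ℂ) =
      ⟪(adjOp (pathTree G u) ^ n) (chi ⟨u, SimpleGraph.Path.nil⟩),
        chi ⟨u, SimpleGraph.Path.nil⟩⟫_ℂ :=
  integral_pow_spectralMeasure (isSelfAdjoint_adjOp _) _ n

/-! ### Atoms, and the three types of vertices -/

/-- The mass `ν_{G,v}({θ})` of the atom `θ` in the matching measure of `G` at `v`. -/
noncomputable def atomMass {V : Type*} (G : SimpleGraph V) [BoundedDegree G] (θ : ℝ) (v : V) : ℝ :=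
  (matchingMeasure G v).real {θ}

open scoped Classical in
/-- The mass `ν_{G-u,v}({θ})` after the vertex `u` is deleted, with the convention
`ν_{G-u,u}({θ}) = 0`. -/
noncomputable def atomMassDelete {V : Type*} (G : SimpleGraph V) [BoundedDegree G] (θ : ℝ)
    (u v : V) : ℝ :=
  if h : v ≠ u then atomMass (deleteVertex G u) θ ⟨v, h⟩ else 0

/-- `u` is `θ`-essential in `G` if `ν_{G,u}({θ}) > 0`. -/
def IsEssential {V : Type*} (G : SimpleGraph V) [BoundedDegree G] (θ : ℝ) (u : V) : Prop :=
  0 < atomMass G θ u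

/-- `u` is `θ`-neutral in `G` if it is not essential and `∑_{v ∼ u} ν_{G-u,v}({θ}) = 0`. -/
def IsNeutral {V : Type*} (G : SimpleGraph V) [BoundedDegree G] (θ : ℝ) (u : V) : Prop :=
  ¬ IsEssential G θ u ∧ ∑ v ∈ nbrs G u, atomMassDelete G θ u v = 0

/-- `u` is `θ`-positive in `G` if `∑_{v ∼ u} ν_{G-u,v}({θ}) > 0`. -/
def IsPositive {V : Type*} (G : SimpleGraph V) [BoundedDegree G] (θ : ℝ) (u : V) : Prop :=
  0 < ∑ v ∈ nbrs G u, atomMassDelete G θ u v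

end MatchingMeasure

namespace MatchingMeasure

open scoped InnerProductSpace ENNReal
open Filter Topology MeasureTheory

/-! ### Resolvents and eigenspaces of self-adjoint operators -/

/-! Write `F_{G,u}(z)` (`rootGreen`) for the diagonal entry at the root of the resolvent `(z - A)⁻¹`
of the path tree, and `a_G(u)` for the atom at `θ`. Removing the root of `T(G,u)` leaves the
disjoint union of the trees `T(G-u,v)`, `v ∼ u`. Hence `1/F_{G,u} = z - ∑_{v∼u} F_{G-u,v}`, and the
whole vector `(z - A)⁻¹ χ_u` is `F_{G,u}` times `χ_u` plus the corresponding vectors of the branches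
(`pathGreen_eq`).

The central identity is of Christoffel–Darboux type (`pathSqSum_eq`): for `w ≠ u`, the sum over all
paths from `u` to `w` of the squared entries of `(z - A)⁻¹ χ_u` equals `F_{G,u} (F_{G,w} -
F_{G-u,w})`. For finitely many edges it follows by induction from the recursion and the exchange
relation `F_{G,u} F_{G-u,w} = F_{G,w} F_{G-w,u}`. The general case is a limit over finite vertex
sets, since the resolvents converge strongly.

Put `z = θ + iε`, multiply by `(iε)²` and let `ε → 0+`. Then `iε (z - A)⁻¹ χ_u` tends to the
projection of `χ_u` to the eigenspace, a real vector of squared norm `a_G(u)`. This gives `a_G(u)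
(a_G(w) - a_{G-u}(w))` as the mass of that vector on the paths ending at `w` (`rootAtom_mul_sub`).
Summing over `w` exhausts the squared norm, and division by `a_G(u) > 0` settles the essential case.

When `u` is positive, divide the identity by `F_{G,u}²` before taking the limit. With `σ = ∑_{v∼u}
a_{G-u}(v)`, the quantity `σ (a_{G-u}(w) - a_G(w))` is the mass on paths ending at `w` of the
eigenvectors of the branches, whose total mass is `σ` (`sum_rootAtom_mul_sub`).

When `u` is neutral every summand is zero: positivity in `rootAtom_mul_sub` makes eigenvectors
vanish where paths would enter or leave `u`, so they can be cut at `u` or extended by zero, and the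
atoms of `G` and `G - u` bound each other. -/

/-- A uniform norm bound makes the family equicontinuous; strong convergence then needs checking
only on a dense set. -/
theorem isClosed_setOf_tendsto_of_norm_le {ι H : Type*} [NormedAddCommGroup H] [NormedSpace ℂ H]
    {l : Filter ι} {T : ι → H →L[ℂ] H} (T₀ : H →L[ℂ] H) {C : ℝ} (hC : ∀ i, ‖T i‖ ≤ C) :
    IsClosed {x | Tendsto (fun i => T i x) l (𝓝 (T₀ x))} := by
  have h : Equicontinuous (fun i => (T i : H → H)) := by
    refine (LipschitzWith.uniformEquicontinuous (fun i => (T i : H → H)) (Real.toNNReal C)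
      fun i => ?_).equicontinuous
    exact (T i).lipschitz.weaken (by
      rw [← NNReal.coe_le_coe, Real.coe_toNNReal']
      exact (hC i).trans (le_max_left _ _))
  exact h.isClosed_setOfPred_tendsto T₀.continuous

/-- The eigenspace of `A` for the real number `θ`. -/
noncomputable abbrev eigenKer {H : Type*} [NormedAddCommGroup H] [InnerProductSpace ℂ H]
    (A : H →L[ℂ] H) (θ : ℝ) : Submodule ℂ H :=
  (A - (θ : ℂ) • ContinuousLinearMap.id ℂ H).ker

theorem mem_eigenKer {H : Type*} [NormedAddCommGroup H] [InnerProductSpace ℂ H]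
    {A : H →L[ℂ] H} {θ : ℝ} {f : H} : f ∈ eigenKer A θ ↔ A f = (θ : ℂ) • f := by
  simp [eigenKer, LinearMap.mem_ker, sub_eq_zero]

section

variable {H : Type*} [NormedAddCommGroup H] [InnerProductSpace ℂ H] [CompleteSpace H]
  {A : H →L[ℂ] H}

/-- `⟪f, A f⟫` is real, so the imaginary part of `⟪f, (z - A) f⟫` is `z.im * ‖f‖²`; Cauchy–Schwarz
finishes. -/
theorem abs_im_mul_norm_le (hA : IsSelfAdjoint A) (z : ℂ) (f : H) :
    |z.im| * ‖f‖ ≤ ‖z • f - A f‖ := by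
  have h1 : (⟪f, z • f - A f⟫_ℂ).im = z.im * ‖f‖ ^ 2 := by
    have h2 : (⟪f, A f⟫_ℂ).im = 0 := by
      have h : (((⟪f, A f⟫_ℂ).re : ℝ) : ℂ) = ⟪f, A f⟫_ℂ := hA.isSymmetric.coe_re_inner_self_apply f
      rw [← h, Complex.ofReal_im]
    rw [inner_sub_right, inner_smul_right, Complex.sub_im, h2, inner_self_eq_norm_sq_to_K]
    simp [← Complex.ofReal_pow]
  have h3 : |z.im| * ‖f‖ ^ 2 ≤ ‖f‖ * ‖z • f - A f‖ := by
    calc |z.im| * ‖f‖ ^ 2 = |(⟪f, z • f - A f⟫_ℂ).im| := by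
          rw [h1, abs_mul, abs_of_nonneg (sq_nonneg ‖f‖)]
      _ ≤ ‖⟪f, z • f - A f⟫_ℂ‖ := Complex.abs_im_le_norm _
      _ ≤ _ := norm_inner_le_norm _ _
  rcases (norm_nonneg f).eq_or_lt with h | h
  · rw [← h]; simp
  · refine le_of_mul_le_mul_left ?_ h
    linarith

/-- The resolvent `(z - A)⁻¹`. -/
noncomputable def resolventOp (A : H →L[ℂ] H) (z : ℂ) : H →L[ℂ] H := resolvent A z

theorem resolventOp_apply_left (hA : IsSelfAdjoint A) {z : ℂ} (hz : z.im ≠ 0) (f : H) :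
    z • resolventOp A z f - A (resolventOp A z f) = f := by
  have hu : IsUnit (algebraMap ℂ (H →L[ℂ] H) z - A) := by
    by_contra h
    exact hz (by rw [hA.mem_spectrum_eq_re (z := z) h]; simp)
  have := Ring.mul_inverse_cancel _ hu
  have h2 := congrArg (fun T : H →L[ℂ] H => T f) this
  simpa [Algebra.algebraMap_eq_smul_one] using! h2

theorem eq_of_smul_sub_eq (hA : IsSelfAdjoint A) {z : ℂ} (hz : z.im ≠ 0) {f g : H}
    (h : z • f - A f = z • g - A g) : f = g := by
  have h1 := abs_im_mul_norm_le hA z (f - g)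
  have h2 : z • (f - g) - A (f - g) = 0 := by
    rw [smul_sub, map_sub, sub_sub_sub_comm, h, sub_self]
  rw [h2, norm_zero] at h1
  have h3 : ‖f - g‖ = 0 := by
    have := abs_pos.2 hz
    nlinarith [norm_nonneg (f - g)]
  exact sub_eq_zero.1 (norm_eq_zero.1 h3)

theorem eq_resolventOp (hA : IsSelfAdjoint A) {z : ℂ} (hz : z.im ≠ 0) {f g : H}
    (h : z • f - A f = g) : f = resolventOp A z g :=
  eq_of_smul_sub_eq hA hz (h.trans (resolventOp_apply_left hA hz g).symm)

theorem norm_resolventOp_le (hA : IsSelfAdjoint A) {z : ℂ} (hz : z.im ≠ 0) :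
    ‖resolventOp A z‖ ≤ |z.im|⁻¹ := by
  refine ContinuousLinearMap.opNorm_le_bound _ (by positivity) fun f => ?_
  have := abs_im_mul_norm_le hA z (resolventOp A z f)
  rw [resolventOp_apply_left hA hz] at this
  rwa [inv_mul_eq_div, le_div_iff₀' (abs_pos.2 hz)]

instance (θ : ℝ) : CompleteSpace (eigenKer A θ) :=
  (ContinuousLinearMap.isClosed_ker _).completeSpace_coe

/-- The orthogonal projection onto the eigenspace of `A` for `θ`. -/
noncomputable def eigenProj (A : H →L[ℂ] H) (θ : ℝ) : H →L[ℂ] H := (eigenKer A θ).starProjection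

theorem apply_eigenProj (θ : ℝ) (f : H) : A (eigenProj A θ f) = (θ : ℂ) • eigenProj A θ f :=
  mem_eigenKer.1 (Submodule.starProjection_apply_mem _ _)

theorem eigenProj_eq_self {θ : ℝ} {f : H} (h : A f = (θ : ℂ) • f) : eigenProj A θ f = f :=
  Submodule.starProjection_eq_self_iff.2 (mem_eigenKer.2 h)

theorem inner_eigenProj_left (θ : ℝ) (f g : H) :
    ⟪eigenProj A θ f, g⟫_ℂ = ⟪f, eigenProj A θ g⟫_ℂ :=
  Submodule.inner_starProjection_left_eq_right _ _ _

theorem inner_eigenProj_self (θ : ℝ) (f : H) :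
    ⟪eigenProj A θ f, f⟫_ℂ = (‖eigenProj A θ f‖ ^ 2 : ℝ) := by
  rw [← eigenProj_eq_self (apply_eigenProj θ f), inner_eigenProj_left,
    eigenProj_eq_self (apply_eigenProj θ f), inner_self_eq_norm_sq_to_K]
  simp

theorem isSelfAdjoint_sub_smul (hA : IsSelfAdjoint A) (θ : ℝ) :
    IsSelfAdjoint (A - (θ : ℂ) • ContinuousLinearMap.id ℂ H) := by
  refine hA.sub ?_
  refine IsSelfAdjoint.smul ?_ (IsSelfAdjoint.one (H →L[ℂ] H))
  simp [isSelfAdjoint_iff]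

/-- A bounded family of operators converges strongly to the projection onto the eigenspace if it
does so on the eigenspace and on the range of `A - θ`. -/
theorem tendsto_eigenProj {ι : Type*} {l : Filter ι} (hA : IsSelfAdjoint A) (θ : ℝ)
    {T : ι → H →L[ℂ] H} {C : ℝ} (hC : ∀ i, ‖T i‖ ≤ C)
    (h1 : ∀ f, A f = (θ : ℂ) • f → Tendsto (fun i => T i f) l (𝓝 f))
    (h2 : ∀ f, Tendsto (fun i => T i (A f - (θ : ℂ) • f)) l (𝓝 0)) (f : H) :
    Tendsto (fun i => T i f) l (𝓝 (eigenProj A θ f)) := by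
  set B := A - (θ : ℂ) • ContinuousLinearMap.id ℂ H with hB
  have hBs : IsSelfAdjoint B := isSelfAdjoint_sub_smul hA θ
  -- By self-adjointness the complement of the eigenspace is the closure of the range of `A - θ`, so
  -- the two hypotheses cover all of `H`.
  have hort : (eigenKer A θ)ᗮ = B.range.topologicalClosure := by
    have := ContinuousLinearMap.orthogonal_ker B
    rwa [(ContinuousLinearMap.isSelfAdjoint_iff'.1 hBs)] at this
  have hcl := isClosed_setOf_tendsto_of_norm_le (l := l) (0 : H →L[ℂ] H) hC
  have h3 : f - eigenProj A θ f ∈ closure (B.range : Set H) := by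
    have : f - eigenProj A θ f ∈ (eigenKer A θ)ᗮ := Submodule.sub_starProjection_mem_orthogonal _
    rw [hort] at this
    exact this
  have h4 : Tendsto (fun i => T i (f - eigenProj A θ f)) l (𝓝 0) := by
    refine closure_minimal ?_ hcl h3
    rintro _ ⟨g, rfl⟩
    simpa [hB] using! h2 g
  have h5 := h4.add (h1 _ (apply_eigenProj θ f))
  simpa using h5

/-- With `R = (θ + iε - A)⁻¹`, the contraction `iεR` fixes the eigenspace and sends `(A - θ) g` to
`iε (iεR g - g)`, which tends to `0`. -/
theorem tendsto_smul_resolventOp (hA : IsSelfAdjoint A) (θ : ℝ) (f : H) :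
    Tendsto (fun ε : ℝ => (ε * Complex.I) • resolventOp A (θ + ε * Complex.I) f) (𝓝[>] 0)
      (𝓝 (eigenProj A θ f)) := by
  -- The index is the subtype of positive `ε` because `tendsto_eigenProj` asks for a norm bound at
  -- every index.
  have key : Tendsto (fun ε : Set.Ioi (0 : ℝ) =>
      (((ε : ℝ) * Complex.I) • resolventOp A (θ + (ε : ℝ) * Complex.I)) f)
      (comap Subtype.val (𝓝 0)) (𝓝 (eigenProj A θ f)) := by
    have him : ∀ ε : Set.Ioi (0 : ℝ), ((θ : ℂ) + (ε : ℝ) * Complex.I).im = ε := by simp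
    have hne : ∀ ε : Set.Ioi (0 : ℝ), ((θ : ℂ) + (ε : ℝ) * Complex.I).im ≠ 0 := fun ε => by
      rw [him]; exact (Set.mem_Ioi.1 ε.2).ne'
    have hb : ∀ ε : Set.Ioi (0 : ℝ),
        ‖((ε : ℝ) * Complex.I) • resolventOp A (θ + (ε : ℝ) * Complex.I)‖ ≤ 1 := fun ε => by
      have h0 : (0 : ℝ) < ε := ε.2
      have := norm_resolventOp_le hA (hne ε)
      rw [him, abs_of_pos h0] at this
      rw [norm_smul, norm_mul, Complex.norm_I, mul_one, Complex.norm_real, Real.norm_eq_abs,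
        abs_of_pos h0]
      calc (ε : ℝ) * _ ≤ ε * (ε : ℝ)⁻¹ := by gcongr
        _ = 1 := mul_inv_cancel₀ h0.ne'
    refine tendsto_eigenProj hA θ hb (fun g hg => ?_) (fun g => ?_) f
    · refine tendsto_const_nhds.congr fun ε => ?_
      have : ((ε : ℝ) * Complex.I) • g = (θ + (ε : ℝ) * Complex.I) • g - A g := by
        rw [hg, add_smul]; simp
      have h2 := eq_resolventOp hA (hne ε) this.symm
      simpa using h2
    · have h0 : Tendsto (fun ε : Set.Ioi (0 : ℝ) => ((ε : ℝ) * Complex.I : ℂ))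
          (comap Subtype.val (𝓝 0)) (𝓝 0) := by
        have h00 : Tendsto (fun x : ℝ => (x * Complex.I : ℂ)) (𝓝 0) (𝓝 0) := by
          have : Continuous (fun x : ℝ => (x * Complex.I : ℂ)) := by fun_prop
          simpa using this.tendsto 0
        exact h00.comp tendsto_comap
      have h1 : ∀ ε : Set.Ioi (0 : ℝ),
          (((ε : ℝ) * Complex.I) • resolventOp A (θ + (ε : ℝ) * Complex.I)) (A g - (θ : ℂ) • g) =
          ((ε : ℝ) * Complex.I) • ((((ε : ℝ) * Complex.I) •
            resolventOp A (θ + (ε : ℝ) * Complex.I)) g - g) := fun ε => by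
        have h3 := eq_resolventOp hA (hne ε) (f := g) rfl
        have h4 : A g - (θ : ℂ) • g =
            ((ε : ℝ) * Complex.I) • g - ((θ + (ε : ℝ) * Complex.I) • g - A g) := by
          rw [add_smul]; abel
        rw [h4, map_sub, map_smul, smul_apply, smul_apply,
          ← h3, ← smul_sub]
      simp_rw [h1]
      refine squeeze_zero_norm (a := fun ε : Set.Ioi (0 : ℝ) =>
        ‖((ε : ℝ) * Complex.I : ℂ)‖ * (2 * ‖g‖)) (fun ε => ?_) ?_
      · rw [norm_smul]
        gcongr
        refine (norm_sub_le _ _).trans ?_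
        have := ContinuousLinearMap.le_of_opNorm_le _ (hb ε) g
        linarith
      · simpa using h0.norm.mul_const (2 * ‖g‖)
  have h2 : 𝓝[>] (0 : ℝ) = map Subtype.val (comap (Subtype.val : Set.Ioi (0 : ℝ) → ℝ) (𝓝 0)) := by
    rw [map_comap, Subtype.range_coe_subtype]; rfl
  rw [h2, tendsto_map'_iff]
  exact key

end

/-! ### Atoms of spectral measures -/

section

variable {H : Type*} [NormedAddCommGroup H] [InnerProductSpace ℂ H] [CompleteSpace H]
  {A : H →L[ℂ] H}

/-- The Poisson bump `ε² / (ε² + (x - θ)²)`. -/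
noncomputable def poissonBump (θ ε x : ℝ) : ℝ := ε ^ 2 / (ε ^ 2 + (x - θ) ^ 2)

theorem continuous_poissonBump (θ : ℝ) {ε : ℝ} (hε : 0 < ε) : Continuous (poissonBump θ ε) := by
  unfold poissonBump
  exact continuous_const.div (by fun_prop) fun x => by positivity

theorem poissonBump_nonneg (θ ε x : ℝ) : 0 ≤ poissonBump θ ε x := by
  unfold poissonBump; positivity

theorem poissonBump_le_one (θ ε x : ℝ) : poissonBump θ ε x ≤ 1 :=
  div_le_one_of_le₀ (by nlinarith [sq_nonneg (x - θ)]) (by positivity)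

theorem abs_poissonBump_mul_le (θ x : ℝ) {ε : ℝ} (hε : 0 < ε) :
    |poissonBump θ ε x * (x - θ)| ≤ ε := by
  have h : 0 < ε ^ 2 + (x - θ) ^ 2 := by positivity
  rw [abs_mul, abs_of_nonneg (poissonBump_nonneg _ _ _), poissonBump, div_mul_eq_mul_div,
    div_le_iff₀ h]
  rw [← sq_abs (x - θ)]
  nlinarith [sq_nonneg (ε - |x - θ|), abs_nonneg (x - θ), mul_pos hε hε]

theorem tendsto_poissonBump (θ x : ℝ) :
    Tendsto (fun ε => poissonBump θ ε x) (𝓝[>] 0) (𝓝 (Set.indicator {θ} 1 x)) := by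
  by_cases hx : x = θ
  · subst hx
    refine tendsto_nhds_of_eventually_eq ?_
    filter_upwards [self_mem_nhdsWithin] with ε hε
    have : ε ≠ 0 := (Set.mem_Ioi.1 hε).ne'
    simp [poissonBump, this]
  · rw [Set.indicator_of_notMem (by simpa using hx)]
    have hx' : (0 : ℝ) ^ 2 + (x - θ) ^ 2 ≠ 0 := by
      simpa using sub_ne_zero.2 hx
    have : ContinuousAt (fun ε => poissonBump θ ε x) 0 := by
      unfold poissonBump
      exact ContinuousAt.div (by fun_prop) (by fun_prop) hx'
    have h := this.tendsto
    simp only [poissonBump, ne_eq, OfNat.ofNat_ne_zero, not_false_eq_true, zero_pow, zero_div] at h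
    exact h.mono_left nhdsWithin_le_nhds

theorem tendsto_cfc_poissonBump (hA : IsSelfAdjoint A) (θ : ℝ) (f : H) :
    Tendsto (fun ε : ℝ => cfc (poissonBump θ ε) A f) (𝓝[>] 0) (𝓝 (eigenProj A θ f)) := by
  have hBc : cfc (fun x : ℝ => x - θ) A = A - (θ : ℂ) • ContinuousLinearMap.id ℂ H := by
    rw [cfc_sub (fun x : ℝ => x) (fun _ => θ) A, cfc_id' ℝ A, cfc_const θ A,
      Algebra.algebraMap_eq_smul_one]
    rfl
  have hBa : ∀ g, cfc (fun x : ℝ => x - θ) A g = A g - (θ : ℂ) • g := fun g => by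
    rw [hBc]; simp
  have key : Tendsto (fun ε : Set.Ioi (0 : ℝ) => cfc (poissonBump θ ε) A f)
      (comap Subtype.val (𝓝 0)) (𝓝 (eigenProj A θ f)) := by
    have hb : ∀ ε : Set.Ioi (0 : ℝ), ‖cfc (poissonBump θ ε) A‖ ≤ 1 := fun ε =>
      norm_cfc_le zero_le_one fun x _ => by
        rw [Real.norm_eq_abs, abs_of_nonneg (poissonBump_nonneg _ _ _)]
        exact poissonBump_le_one _ _ _
    have hmul : ∀ (g h : ℝ → ℝ) (x : H), Continuous g → Continuous h →
        cfc g A (cfc h A x) = cfc (fun y => g y * h y) A x := fun g h x hg hh => by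
      rw [cfc_mul g h A hg.continuousOn hh.continuousOn]; rfl
    refine tendsto_eigenProj hA θ hb (fun g hg => ?_) (fun g => ?_) f
    · refine tendsto_const_nhds.congr fun ε => ?_
      have h0 : (0 : ℝ) < ε := ε.2
      have hq : Continuous (fun x : ℝ => -(x - θ) / ((ε : ℝ) ^ 2 + (x - θ) ^ 2)) :=
        Continuous.div (by fun_prop) (by fun_prop) fun x => by positivity
      have h1 : cfc (fun x : ℝ => x - θ) A g = 0 := by rw [hBa, hg, sub_self]
      -- The bump is `1` plus a continuous multiple of `x - θ`, hence acts as the identity on the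
      -- kernel of `A - θ`.
      have h2 : poissonBump θ ε =
          fun x => 1 + (-(x - θ) / ((ε : ℝ) ^ 2 + (x - θ) ^ 2)) * (x - θ) := by
        ext x
        have : (ε : ℝ) ^ 2 + (x - θ) ^ 2 ≠ 0 := by positivity
        unfold poissonBump
        field_simp
        ring
      rw [h2, cfc_add (a := A) (fun _ : ℝ => (1 : ℝ))
        (fun x => (-(x - θ) / ((ε : ℝ) ^ 2 + (x - θ) ^ 2)) * (x - θ)) (by fun_prop)
        (hq.mul (by fun_prop)).continuousOn, cfc_const_one ℝ A]
      rw [add_apply, ← hmul _ _ _ hq (by fun_prop), h1]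
      simp
    · refine squeeze_zero_norm (a := fun ε : Set.Ioi (0 : ℝ) => (ε : ℝ) * ‖g‖) (fun ε => ?_) ?_
      · have h0 : (0 : ℝ) < ε := ε.2
        rw [← hBa, hmul _ _ _ (continuous_poissonBump θ h0) (by fun_prop)]
        refine ContinuousLinearMap.le_of_opNorm_le _ (norm_cfc_le h0.le fun x _ => ?_) g
        exact abs_poissonBump_mul_le θ x h0
      · have : Tendsto (fun ε : Set.Ioi (0 : ℝ) => (ε : ℝ)) (comap Subtype.val (𝓝 0)) (𝓝 0) :=
          tendsto_comap
        simpa using this.mul_const ‖g‖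
  have h2 : 𝓝[>] (0 : ℝ) = map Subtype.val (comap (Subtype.val : Set.Ioi (0 : ℝ) → ℝ) (𝓝 0)) := by
    rw [map_comap, Subtype.range_coe_subtype]; rfl
  rw [h2, tendsto_map'_iff]
  exact key

/-- The mass of the atom `θ` in the spectral measure at `ξ` is `⟨Π ξ, ξ⟩`, where `Π` is the
projection onto the eigenspace. -/
theorem spectralMeasure_real_singleton (hA : IsSelfAdjoint A) (ξ : H) (θ : ℝ) :
    (((spectralMeasure A ξ).real {θ} : ℝ) : ℂ) = ⟪eigenProj A θ ξ, ξ⟫_ℂ := by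
  have hfin : IsFiniteMeasure (spectralMeasure A ξ) :=
    ⟨by rw [spectralMeasure_univ hA]; exact ENNReal.ofReal_lt_top⟩
  have h1 : Tendsto (fun ε => ∫ x, poissonBump θ ε x ∂(spectralMeasure A ξ)) (𝓝[>] 0)
      (𝓝 (∫ x, Set.indicator {θ} 1 x ∂(spectralMeasure A ξ))) := by
    refine tendsto_integral_filter_of_dominated_convergence (fun _ => 1) ?_ ?_
      (integrable_const _) (Eventually.of_forall fun x => tendsto_poissonBump θ x)
    · filter_upwards [self_mem_nhdsWithin] with ε hε
      exact (continuous_poissonBump θ hε).aestronglyMeasurable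
    · refine Eventually.of_forall fun ε => Eventually.of_forall fun x => ?_
      rw [Real.norm_eq_abs, abs_of_nonneg (poissonBump_nonneg _ _ _)]
      exact poissonBump_le_one _ _ _
  rw [integral_indicator_one (measurableSet_singleton θ)] at h1
  have h2 : Tendsto (fun ε => ∫ x, poissonBump θ ε x ∂(spectralMeasure A ξ)) (𝓝[>] 0)
      (𝓝 (⟪eigenProj A θ ξ, ξ⟫_ℂ).re) := by
    have h3 : Tendsto (fun ε : ℝ => (⟪cfc (poissonBump θ ε) A ξ, ξ⟫_ℂ).re) (𝓝[>] 0)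
        (𝓝 (⟪eigenProj A θ ξ, ξ⟫_ℂ).re) :=
      (Complex.continuous_re.tendsto _).comp
        ((tendsto_cfc_poissonBump hA θ ξ).inner tendsto_const_nhds)
    refine h3.congr' ?_
    filter_upwards [self_mem_nhdsWithin] with ε hε
    exact (integral_spectralMeasure A ξ (continuous_poissonBump θ hε)).symm
  rw [tendsto_nhds_unique h1 h2, inner_eigenProj_self, Complex.ofReal_re]

end

/-! ### Extension, restriction and conjugation in `ℓ²` -/

section

variable {X Y : Type*}

theorem chi_apply_self (x : X) : (chi x : L2 X) x = 1 := by
  simp [chi]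

theorem chi_apply_ne {x y : X} (h : y ≠ x) : (chi x : L2 X) y = 0 := by
  simp [chi, h]

theorem inner_chi_left (x : X) (f : L2 X) : ⟪chi x, f⟫_ℂ = f x := by
  classical
  simp [chi, lp.inner_single_left]

theorem norm_chi (x : X) : ‖(chi x : L2 X)‖ = 1 := by
  classical
  simp [chi, lp.norm_single]

theorem hasSum_norm_sq (f : L2 X) : HasSum (fun x => ‖f x‖ ^ 2) (‖f‖ ^ 2) := by
  have := lp.hasSum_norm (p := 2) (by simp) f
  simpa using this

theorem memℓp_two_of_summable {f : X → ℂ} (h : Summable fun x => ‖f x‖ ^ 2) :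
    Memℓp f 2 := by
  refine memℓp_gen ?_
  simpa using h

theorem norm_sq_extend (φ : X ↪ Y) (f : X → ℂ) (y : Y) :
    ‖Function.extend φ f 0 y‖ ^ 2 = Function.extend φ (fun x => ‖f x‖ ^ 2) 0 y := by
  classical
  by_cases h : ∃ x, φ x = y
  · obtain ⟨x, rfl⟩ := h
    simp [φ.injective.extend_apply]
  · simp [Function.extend_apply' _ _ _ h]

/-- Extension by zero along an injection, as an isometry of `ℓ²` spaces. -/
noncomputable def extendL2 (φ : X ↪ Y) : L2 X →ₗᵢ[ℂ] L2 Y where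
  toFun f := ⟨Function.extend φ f 0, memℓp_two_of_summable (by
    simp_rw [norm_sq_extend]
    exact (summable_extend_zero φ.injective).2 (hasSum_norm_sq f).summable)⟩
  map_add' f g := by
    ext y
    change Function.extend φ (⇑f + ⇑g) 0 y = Function.extend φ f 0 y + Function.extend φ g 0 y
    by_cases h : ∃ x, φ x = y
    · obtain ⟨x, rfl⟩ := h
      simp [φ.injective.extend_apply]
    · simp [Function.extend_apply' _ _ _ h]
  map_smul' c f := by
    ext y
    change Function.extend φ (c • ⇑f) 0 y = c • Function.extend φ f 0 y
    by_cases h : ∃ x, φ x = y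
    · obtain ⟨x, rfl⟩ := h
      simp [φ.injective.extend_apply]
    · simp [Function.extend_apply' _ _ _ h]
  norm_map' f := by
    refine (sq_eq_sq₀ (norm_nonneg _) (norm_nonneg _)).1 ?_
    refine (hasSum_norm_sq _).unique ?_
    change HasSum (fun y => ‖Function.extend φ f 0 y‖ ^ 2) (‖f‖ ^ 2)
    simp_rw [norm_sq_extend]
    exact (hasSum_extend_zero φ.injective).2 (hasSum_norm_sq f)

@[simp] theorem extendL2_apply (φ : X ↪ Y) (f : L2 X) (x : X) : extendL2 φ f (φ x) = f x :=
  φ.injective.extend_apply f (0 : Y → ℂ) x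

theorem extendL2_apply_of_notMem (φ : X ↪ Y) (f : L2 X) {y : Y} (h : ¬ ∃ x, φ x = y) :
    extendL2 φ f y = 0 :=
  Function.extend_apply' f (0 : Y → ℂ) y h

/-- Restriction of a square summable function to a set. -/
noncomputable def restrictL2 (s : Set X) : L2 X →L[ℂ] L2 s :=
  LinearMap.mkContinuous
    { toFun := fun f => ⟨fun x => f x, memℓp_two_of_summable
        ((hasSum_norm_sq f).summable.subtype s)⟩
      map_add' := fun _ _ => rfl
      map_smul' := fun _ _ => rfl } 1 fun f => by
    rw [one_mul]
    refine (sq_le_sq₀ (norm_nonneg _) (norm_nonneg _)).1 ?_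
    rw [← (hasSum_norm_sq f).tsum_eq, ← (hasSum_norm_sq _).tsum_eq]
    exact (hasSum_norm_sq f).summable.tsum_subtype_le _ s (fun _ => by positivity)

@[simp] theorem restrictL2_apply (s : Set X) (f : L2 X) (x : s) : restrictL2 s f x = f x := rfl

theorem hasSum_sq (f : L2 X) : HasSum (fun x => f x ^ 2) ⟪star f, f⟫_ℂ := by
  have := lp.hasSum_inner (𝕜 := ℂ) (star f) f
  simpa [sq] using this

/-- `∑ f(x)²` over `x ∈ s`. -/
noncomputable def sqSum (s : Set X) (f : L2 X) : ℂ := ∑' x : s, f x ^ 2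

/-- Continuity in the `ℓ²` norm is what carries sums over infinitely many paths through both limits,
over finite subgraphs and over `ε → 0+`. The squares are bilinear, without conjugation, to match the
algebraic identities between Green functions. -/
theorem continuous_sqSum (s : Set X) : Continuous (sqSum s) := by
  have : sqSum s = fun f => ⟪star (restrictL2 s f), restrictL2 s f⟫_ℂ :=
    funext fun f => (hasSum_sq (restrictL2 s f)).tsum_eq
  rw [this]
  fun_prop

theorem sqSum_smul (s : Set X) (c : ℂ) (f : L2 X) : sqSum s (c • f) = c ^ 2 * sqSum s f := by
  simp [sqSum, mul_pow, tsum_mul_left]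

theorem sqSum_congr {s : Set X} {f g : L2 X} (h : ∀ x ∈ s, f x = g x) : sqSum s f = sqSum s g :=
  tsum_congr fun x => by rw [h x x.2]

theorem sqSum_eq_zero {s : Set X} {f : L2 X} (h : ∀ x ∈ s, f x = 0) : sqSum s f = 0 := by
  rw [sqSum, tsum_congr fun x : s => by rw [h x x.2]]
  simp

theorem sqSum_eq_single {s : Set X} {f : L2 X} {x : X} (hx : x ∈ s)
    (h : ∀ y ∈ s, y ≠ x → f y = 0) : sqSum s f = f x ^ 2 := by
  rw [sqSum, tsum_eq_single ⟨x, hx⟩]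
  intro y hy
  rw [h y y.2 fun h => hy (Subtype.ext h)]
  simp

theorem sqSum_extendL2 (φ : X ↪ Y) (s : Set Y) (f : L2 X) :
    sqSum s (extendL2 φ f) = sqSum (φ ⁻¹' s) f := by
  classical
  unfold sqSum
  rw [tsum_subtype s (fun y => extendL2 φ f y ^ 2), tsum_subtype (φ ⁻¹' s) (fun x => f x ^ 2)]
  rw [← tsum_extend_zero φ.injective]
  refine tsum_congr fun y => ?_
  by_cases h : ∃ x, φ x = y
  · obtain ⟨x, rfl⟩ := h
    rw [φ.injective.extend_apply]
    by_cases hx : φ x ∈ s <;> simp [Set.indicator, hx]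
  · rw [Function.extend_apply' _ _ _ h]
    simp [Set.indicator, extendL2_apply_of_notMem φ f h]

theorem sqSum_sum {ι : Type*} (t : Finset ι) (s : Set X) (f : ι → L2 X)
    (h : ∀ i ∈ t, ∀ j ∈ t, i ≠ j → ∀ x, f i x * f j x = 0) :
    sqSum s (∑ i ∈ t, f i) = ∑ i ∈ t, sqSum s (f i) := by
  classical
  have h1 : ∀ x, (∑ i ∈ t, f i : L2 X) x ^ 2 = ∑ i ∈ t, f i x ^ 2 := fun x => by
    rw [lp.coeFn_sum, Finset.sum_apply, sq, Finset.sum_mul_sum]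
    refine Finset.sum_congr rfl fun i hi => ?_
    rw [Finset.sum_eq_single i, sq]
    · exact fun j hj hij => h i hi j hj hij.symm x
    · exact fun h => absurd hi h
  unfold sqSum
  simp_rw [h1]
  exact Summable.tsum_finsetSum fun i _ => (hasSum_sq (f i)).summable.subtype s

/-- Summing `f²` over the fibres of a partial map. -/
theorem hasSum_sqSum_fiber {W : Type*} (g : X → Option W) (f : L2 X)
    (h : ∀ x, g x = none → f x = 0) :
    HasSum (fun w => sqSum (g ⁻¹' {some w}) f) ⟪star f, f⟫_ℂ := by
  have h1 : HasSum (fun w : Option W => sqSum (g ⁻¹' {w}) f) ⟪star f, f⟫_ℂ :=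
    (hasSum_sq f).tsum_fiberwise g
  refine ((Option.some_injective W).hasSum_iff ?_).2 h1
  intro w hw
  cases w with
  | none => exact sqSum_eq_zero fun x hx => h x hx
  | some w => exact absurd ⟨w, rfl⟩ hw

theorem inner_star_star (f g : L2 X) : ⟪star f, star g⟫_ℂ = ⟪g, f⟫_ℂ := by
  rw [lp.inner_eq_tsum, lp.inner_eq_tsum]
  refine tsum_congr fun x => ?_
  simp [mul_comm]

end

/-! ### Green functions and atoms of rooted graphs -/

section

variable {X Y : Type*} (T : SimpleGraph X) [BoundedDegree T]

theorem star_adjOp (f : L2 X) : star (adjOp T f) = adjOp T (star f) := by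
  ext x
  simp [star_sum]

/-- The vector `(z - A)⁻¹ χ_o`. -/
noncomputable def green (z : ℂ) (o : X) : L2 X := resolventOp (adjOp T) z (chi o)

variable {T}

theorem green_apply {z : ℂ} (hz : z.im ≠ 0) (o x : X) :
    z * green T z o x - ∑ y ∈ nbrs T x, green T z o y = (chi o : L2 X) x := by
  have := resolventOp_apply_left (isSelfAdjoint_adjOp T) hz (chi o)
  exact congrArg (fun f : L2 X => f x) this

theorem eq_smul_green {z : ℂ} (hz : z.im ≠ 0) {o : X} {f : L2 X} {c : ℂ}
    (h : ∀ x, z * f x - ∑ y ∈ nbrs T x, f y = c * (chi o : L2 X) x) : f = c • green T z o := by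
  have : z • f - adjOp T f = c • (chi o : L2 X) := by
    ext x
    exact h x
  rw [eq_resolventOp (isSelfAdjoint_adjOp T) hz this, map_smul]
  rfl

variable (T)

/-- The mass of the atom `θ` of the spectral measure of `T` at the vertex `o`. -/
noncomputable def atomAt (θ : ℝ) (o : X) : ℝ := (spectralMeasure (adjOp T) (chi o)).real {θ}

/-- The projection of `χ_o` to the eigenspace of `T` for `θ`. -/
noncomputable def eigVec (θ : ℝ) (o : X) : L2 X := eigenProj (adjOp T) θ (chi o)

variable {T}

theorem ofReal_atomAt (θ : ℝ) (o : X) : (atomAt T θ o : ℂ) = eigVec T θ o o := by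
  rw [atomAt, spectralMeasure_real_singleton (isSelfAdjoint_adjOp T), inner_eigenProj_left,
    inner_chi_left]
  rfl

theorem atomAt_eq_norm_sq (θ : ℝ) (o : X) : atomAt T θ o = ‖eigVec T θ o‖ ^ 2 := by
  have := spectralMeasure_real_singleton (isSelfAdjoint_adjOp T) (chi o) θ
  rw [inner_eigenProj_self] at this
  exact_mod_cast this

theorem atomAt_nonneg (θ : ℝ) (o : X) : 0 ≤ atomAt T θ o := measureReal_nonneg

theorem sum_nbrs_eigVec (θ : ℝ) (o x : X) :
    ∑ y ∈ nbrs T x, eigVec T θ o y = θ * eigVec T θ o x :=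
  congrArg (fun f : L2 X => f x) (apply_eigenProj (A := adjOp T) θ (chi o))

theorem tendsto_smul_green (θ : ℝ) (o : X) :
    Tendsto (fun ε : ℝ => (ε * Complex.I) • green T (θ + ε * Complex.I) o) (𝓝[>] 0)
      (𝓝 (eigVec T θ o)) :=
  tendsto_smul_resolventOp (isSelfAdjoint_adjOp T) θ (chi o)

/-- Conjugation preserves the eigenspace and fixes `χ_o`, so the projection is real. Bilinear
squares thereby become squared norms, which supplies positivity. -/
theorem star_eigVec (θ : ℝ) (o : X) : star (eigVec T θ o) = eigVec T θ o := by
  have hstar : ∀ f : L2 X, adjOp T f = (θ : ℂ) • f → adjOp T (star f) = (θ : ℂ) • star f :=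
    fun f hf => by rw [← star_adjOp, hf, star_smul]; simp
  have h1 := hstar _ (apply_eigenProj (A := adjOp T) θ (chi o))
  have hchi : star (chi o : L2 X) = chi o := by
    ext x
    by_cases h : x = o
    · subst h; simp [chi_apply_self]
    · simp [chi_apply_ne h]
  refine Eq.symm (Submodule.eq_starProjection_of_mem_of_inner_eq_zero
    (K := eigenKer (adjOp T) θ) (mem_eigenKer.2 h1) fun g hg => ?_)
  have h2 : eigenProj (adjOp T) θ (star g) = star g :=
    eigenProj_eq_self (hstar g (mem_eigenKer.1 hg))
  have h3 := inner_star_star (chi o - eigVec T θ o) (star g)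
  rw [star_star, star_sub, hchi] at h3
  refine h3.trans ?_
  rw [inner_sub_right, ← h2, inner_eigenProj_left, inner_eigenProj_left, eigVec,
    eigenProj_eq_self (apply_eigenProj θ (chi o)), sub_self]

theorem hasSum_eigVec_sq (θ : ℝ) (o : X) :
    HasSum (fun x => eigVec T θ o x ^ 2) (atomAt T θ o : ℂ) := by
  have := hasSum_sq (eigVec T θ o)
  rw [star_eigVec, inner_self_eq_norm_sq_to_K] at this
  rw [atomAt_eq_norm_sq]
  simpa using this

theorem eigVec_sq (θ : ℝ) (o x : X) : eigVec T θ o x ^ 2 = (‖eigVec T θ o x‖ ^ 2 : ℝ) := by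
  have h : star (eigVec T θ o x) = eigVec T θ o x := by
    conv_rhs => rw [← star_eigVec]
    rw [lp.star_apply]
  have h2 := Complex.mul_conj' (eigVec T θ o x)
  rw [show (starRingEnd ℂ) (eigVec T θ o x) = eigVec T θ o x from h] at h2
  rw [sq, h2]; simp

theorem sqSum_eigVec (θ : ℝ) (o : X) (s : Set X) :
    sqSum s (eigVec T θ o) = (∑' x : s, ‖eigVec T θ o x‖ ^ 2 : ℝ) := by
  rw [sqSum, Complex.ofReal_tsum]
  exact tsum_congr fun x => eigVec_sq θ o x

/-- An eigenvector bounds the atom from below. -/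
theorem norm_sq_le_mul_atomAt {θ : ℝ} {f : L2 X} (h : ∀ x, ∑ y ∈ nbrs T x, f y = θ * f x) (o : X) :
    ‖f o‖ ^ 2 ≤ ‖f‖ ^ 2 * atomAt T θ o := by
  have hf : adjOp T f = (θ : ℂ) • f := by
    ext x
    exact h x
  have h1 : f o = ⟪eigVec T θ o, f⟫_ℂ := by
    rw [eigVec, inner_eigenProj_left, eigenProj_eq_self hf, inner_chi_left]
  rw [h1, atomAt_eq_norm_sq, ← mul_pow, mul_comm]
  gcongr
  exact norm_inner_le_norm _ _

/-- An isomorphism of `T` with a union of components of `S` preserves Green functions. -/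
theorem green_extendL2 {S : SimpleGraph Y} [BoundedDegree S] (φ : X ↪ Y)
    (hφ : ∀ x y, S.Adj (φ x) y ↔ ∃ x', φ x' = y ∧ T.Adj x x') {z : ℂ} (hz : z.im ≠ 0) (o : X) :
    green S z (φ o) = extendL2 φ (green T z o) := by
  rw [← one_smul ℂ (green S z (φ o))]
  refine (eq_smul_green hz fun y => ?_).symm
  by_cases h : ∃ x, φ x = y
  · obtain ⟨x, rfl⟩ := h
    have h1 : nbrs S (φ x) = (nbrs T x).map φ := by
      ext y
      simp [hφ, and_comm]
    rw [h1, Finset.sum_map]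
    simp only [extendL2_apply]
    rw [green_apply hz, one_mul]
    by_cases hx : x = o
    · subst hx; simp [chi_apply_self]
    · rw [chi_apply_ne hx, chi_apply_ne (φ.injective.ne hx)]
  · rw [extendL2_apply_of_notMem φ _ h, Finset.sum_eq_zero, chi_apply_ne]
    · simp
    · exact fun h' => h ⟨o, h'.symm⟩
    · intro y' hy'
      refine extendL2_apply_of_notMem φ _ ?_
      rintro ⟨x', rfl⟩
      rw [mem_nbrs, SimpleGraph.adj_comm, hφ] at hy'
      obtain ⟨x, hx, -⟩ := hy'
      exact h ⟨x, hx⟩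

theorem tendsto_mul_green_self (θ : ℝ) (o : X) :
    Tendsto (fun ε : ℝ => (ε * Complex.I) * green T (θ + ε * Complex.I) o o) (𝓝[>] 0)
      (𝓝 (atomAt T θ o)) := by
  rw [ofReal_atomAt]
  have := ((lp.evalCLM ℂ (fun _ : X => ℂ) 2 o).continuous.tendsto _).comp
    (tendsto_smul_green (T := T) θ o)
  exact this

theorem im_ne_zero_of_pos {θ ε : ℝ} (hε : 0 < ε) : ((θ : ℂ) + ε * Complex.I).im ≠ 0 := by
  simpa using hε.ne'

/-- The atom is a limit of diagonal Green entries, and these do not see vertices outside the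
components that `φ` covers. -/
theorem atomAt_embedding {S : SimpleGraph Y} [BoundedDegree S] (φ : X ↪ Y)
    (hφ : ∀ x y, S.Adj (φ x) y ↔ ∃ x', φ x' = y ∧ T.Adj x x') (θ : ℝ) (o : X) :
    atomAt S θ (φ o) = atomAt T θ o := by
  have h := (tendsto_mul_green_self (T := S) θ (φ o))
  have h2 : Tendsto (fun ε : ℝ => (ε * Complex.I) * green S (θ + ε * Complex.I) (φ o) (φ o))
      (𝓝[>] 0) (𝓝 (atomAt T θ o)) := by
    refine (tendsto_mul_green_self (T := T) θ o).congr' ?_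
    filter_upwards [self_mem_nhdsWithin] with ε hε
    rw [green_extendL2 φ hφ (im_ne_zero_of_pos hε), extendL2_apply]
  exact_mod_cast tendsto_nhds_unique h h2

end

/-! ### Convergence of Green functions -/

section

variable {X : Type*}

theorem adjOp_chi_apply [DecidableEq X] (T : SimpleGraph X) [BoundedDegree T] (x y : X) :
    adjOp T (chi x) y = if x ∈ nbrs T y then 1 else 0 := by
  rw [adjOp_apply]
  have : ∀ w, (chi x : L2 X) w = if w = x then 1 else 0 := fun w => by
    by_cases h : w = x
    · subst h; simp [chi_apply_self]
    · simp [h, chi_apply_ne h]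
  simp [this]

/-- On a point mass the images are eventually equal; point masses span a dense subspace and the
degrees are uniformly bounded. -/
theorem tendsto_adjOp {ι : Type*} {l : Filter ι} {T : ι → SimpleGraph X}
    [∀ i, BoundedDegree (T i)] {T₀ : SimpleGraph X} [BoundedDegree T₀] {D : ℕ}
    (hD : ∀ i v, ((T i).neighborSet v).encard ≤ D)
    (h : ∀ x, ∀ᶠ i in l, ∀ y, (T i).Adj x y ↔ T₀.Adj x y) (f : L2 X) :
    Tendsto (fun i => adjOp (T i) f) l (𝓝 (adjOp T₀ f)) := by
  classical
  have hcl := isClosed_setOf_tendsto_of_norm_le (l := l) (adjOp T₀)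
    fun i => norm_adjOp_le (T i) (hD i)
  have hs := lp.hasSum_single (p := 2) (by simp) f
  refine hcl.mem_of_tendsto hs (Eventually.of_forall fun s => ?_)
  simp only [Set.mem_ofPred_eq, map_sum]
  refine tendsto_finsetSum _ fun x _ => ?_
  have h1 : lp.single 2 x (f x) = f x • (chi x : L2 X) := by
    rw [chi, ← lp.single_smul, smul_eq_mul, mul_one]
  rw [h1]
  refine tendsto_nhds_of_eventually_eq ?_
  filter_upwards [h x] with i hi
  rw [map_smul, map_smul]
  congr 1
  ext y
  rw [adjOp_chi_apply, adjOp_chi_apply]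
  simp [SimpleGraph.adj_comm, hi]

/-- This is the second resolvent identity: the error solves the resolvent equation of `T i` with
right-hand side `(A_i - A₀)` applied to the limit vector. -/
theorem tendsto_green {ι : Type*} {l : Filter ι} {T : ι → SimpleGraph X}
    [∀ i, BoundedDegree (T i)] {T₀ : SimpleGraph X} [BoundedDegree T₀] {D : ℕ}
    (hD : ∀ i v, ((T i).neighborSet v).encard ≤ D)
    (h : ∀ x, ∀ᶠ i in l, ∀ y, (T i).Adj x y ↔ T₀.Adj x y) {z : ℂ} (hz : z.im ≠ 0) (o : X) :
    Tendsto (fun i => green (T i) z o) l (𝓝 (green T₀ z o)) := by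
  have h1 := tendsto_adjOp hD h (green T₀ z o)
  rw [tendsto_iff_norm_sub_tendsto_zero] at h1 ⊢
  refine squeeze_zero (fun _ => norm_nonneg _) (fun i => ?_)
    (by simpa using h1.const_mul |z.im|⁻¹)
  have h2 := abs_im_mul_norm_le (isSelfAdjoint_adjOp (T i)) z (green (T i) z o - green T₀ z o)
  have h3 : z • (green (T i) z o - green T₀ z o) - adjOp (T i) (green (T i) z o - green T₀ z o) =
      adjOp (T i) (green T₀ z o) - adjOp T₀ (green T₀ z o) := by
    have e1 := resolventOp_apply_left (isSelfAdjoint_adjOp (T i)) hz (chi o)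
    have e2 := resolventOp_apply_left (isSelfAdjoint_adjOp T₀) hz (chi o)
    change z • green (T i) z o - adjOp (T i) (green (T i) z o) = chi o at e1
    change z • green T₀ z o - adjOp T₀ (green T₀ z o) = chi o at e2
    rw [smul_sub, map_sub, sub_sub_sub_comm, e1, ← e2]
    abel
  rw [h3] at h2
  rwa [le_inv_mul_iff₀ (abs_pos.2 hz)]

end

/-! ### Restricted graphs -/

section

variable {V : Type*} (G : SimpleGraph V)

/-- The graph on the same vertices that keeps the edges of `G` inside `S`. -/
def keep (S : Set V) : SimpleGraph V where
  Adj a b := G.Adj a b ∧ a ∈ S ∧ b ∈ S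
  symm := ⟨fun _ _ h => ⟨h.1.symm, h.2.2, h.2.1⟩⟩
  loopless := ⟨fun _ h => G.loopless.irrefl _ h.1⟩

/-- The graph `G` with the edges at `u` deleted, on the same vertices. -/
abbrev del (u : V) : SimpleGraph V := keep G {u}ᶜ

variable {G}

theorem keep_adj {S : Set V} {a b : V} : (keep G S).Adj a b ↔ G.Adj a b ∧ a ∈ S ∧ b ∈ S := Iff.rfl

theorem del_adj {u a b : V} : (del G u).Adj a b ↔ G.Adj a b ∧ a ≠ u ∧ b ≠ u := Iff.rfl

theorem keep_keep_comm (S S' : Set V) : keep (keep G S) S' = keep (keep G S') S := by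
  ext a b
  simp only [keep_adj]
  tauto

theorem encard_neighborSet_keep_le (S : Set V) (v : V) :
    ((keep G S).neighborSet v).encard ≤ (G.neighborSet v).encard :=
  Set.encard_le_encard fun _ h => h.1

instance [hG : BoundedDegree G] (S : Set V) : BoundedDegree (keep G S) := by
  obtain ⟨D, hD⟩ := hG.exists_bound
  exact ⟨D, fun v => (encard_neighborSet_keep_le S v).trans (hD v)⟩

theorem nbrs_del [DecidableEq V] [BoundedDegree G] {u v : V} (huv : v ≠ u) :
    nbrs (del G u) v = (nbrs G v).erase u := by
  ext w
  simp only [mem_nbrs, del_adj, Finset.mem_erase]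
  tauto

end

/-! ### The path tree on lists of vertices -/

section

variable {V : Type*} {G : SimpleGraph V}

/-- `l` lists the vertices of a path of `G` that starts at `u`. -/
def IsPathList (G : SimpleGraph V) (u : V) (l : List V) : Prop :=
  l.head? = some u ∧ l.IsChain G.Adj ∧ l.Nodup

theorem isPathList_nil (u : V) : ¬ IsPathList G u [] := by
  simp [IsPathList]

theorem isPathList_singleton {u v : V} : IsPathList G u [v] ↔ v = u := by
  simp [IsPathList]

theorem IsPathList.head_eq {u a : V} {l : List V} (h : IsPathList G u (a :: l)) : a = u := by
  simpa using h.1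

theorem isChain_keep {S : Set V} : ∀ {v : V} {l : List V}, v ∈ S →
    ((v :: l).IsChain (keep G S).Adj ↔ (v :: l).IsChain G.Adj ∧ ∀ x ∈ l, x ∈ S)
  | v, [], _ => by simp
  | v, a :: l, hv => by
    rw [List.isChain_cons_cons, List.isChain_cons_cons, keep_adj]
    constructor
    · rintro ⟨⟨h1, -, h2⟩, h3⟩
      have := (isChain_keep h2).1 h3
      exact ⟨⟨h1, this.1⟩, by simpa using ⟨h2, this.2⟩⟩
    · rintro ⟨⟨h1, h2⟩, h3⟩
      have ha : a ∈ S := h3 a (by simp)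
      exact ⟨⟨h1, hv, ha⟩, (isChain_keep ha).2 ⟨h2, fun x hx => h3 x (by simp [hx])⟩⟩

theorem isPathList_keep {S : Set V} {v : V} (hv : v ∈ S) {l : List V} :
    IsPathList (keep G S) v l ↔ IsPathList G v l ∧ ∀ x ∈ l, x ∈ S := by
  cases l with
  | nil => simp [isPathList_nil]
  | cons a l =>
    by_cases ha : a = v
    · subst ha
      simp only [IsPathList, isChain_keep hv, List.mem_cons, forall_eq_or_imp]
      tauto
    · simp [IsPathList, ha]

theorem isPathList_del {u v : V} (hv : v ≠ u) {l : List V} :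
    IsPathList (del G u) v l ↔ IsPathList G v l ∧ u ∉ l := by
  rw [isPathList_keep (S := {u}ᶜ) hv]
  refine and_congr_right fun _ => ⟨fun h hu => h u hu rfl, fun h x hx => ?_⟩
  rintro rfl
  exact h hx

theorem isPathList_cons {u a : V} {l : List V} (hl : l ≠ []) :
    IsPathList G u (a :: l) ↔ a = u ∧ ∃ v, G.Adj u v ∧ IsPathList (del G u) v l := by
  obtain ⟨b, l, rfl⟩ := List.exists_cons_of_ne_nil hl
  constructor
  · rintro h
    obtain rfl := h.head_eq
    obtain ⟨-, h2, h3⟩ := h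
    rw [List.isChain_cons_cons] at h2
    rw [List.nodup_cons] at h3
    exact ⟨rfl, b, h2.1, (isPathList_del h2.1.ne').2 ⟨⟨rfl, h2.2, h3.2⟩, h3.1⟩⟩
  · rintro ⟨rfl, v, hv, h⟩
    obtain rfl := h.head_eq
    rw [isPathList_del hv.ne'] at h
    exact ⟨rfl, List.isChain_cons_cons.2 ⟨hv, h.1.2.1⟩, List.nodup_cons.2 ⟨h.2, h.1.2.2⟩⟩

theorem IsPathList.append_left {u : V} {l m : List V} (hl : l ≠ []) (h : IsPathList G u (l ++ m)) :
    IsPathList G u l := by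
  obtain ⟨h1, h2, h3⟩ := h
  refine ⟨?_, h2.left_of_append, h3.of_append_left⟩
  obtain ⟨b, l, rfl⟩ := List.exists_cons_of_ne_nil hl
  simpa using h1

/-- The path tree of `G` at `u`, on the lists of vertices; lists that are not paths from `u` are
isolated. -/
def listTree (G : SimpleGraph V) (u : V) : SimpleGraph (List V) where
  Adj l m := IsPathList G u l ∧ IsPathList G u m ∧ ((∃ x, m = l ++ [x]) ∨ ∃ x, l = m ++ [x])
  symm := ⟨fun _ _ h => ⟨h.2.1, h.1, h.2.2.symm⟩⟩
  loopless := ⟨fun l h => by simp at h⟩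

theorem listTree_adj {u : V} {l m : List V} : (listTree G u).Adj l m ↔
    IsPathList G u l ∧ IsPathList G u m ∧ ((∃ x, m = l ++ [x]) ∨ ∃ x, l = m ++ [x]) := Iff.rfl

theorem IsPathList.adj_of_append {u x w : V} {l : List V} (h : IsPathList G u (l ++ [x]))
    (hw : l.getLast? = some w) : G.Adj w x := by
  have := h.2.1
  rw [List.isChain_append] at this
  exact this.2.2 w hw x rfl

/-- At most `D` neighbours prolong the list and one shortens it. The crude bound suffices, since
only its uniformity is used. -/
theorem encard_neighborSet_listTree_le {D : ℕ} (hD : ∀ v, (G.neighborSet v).encard ≤ D) (u : V)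
    (l : List V) : ((listTree G u).neighborSet l).encard ≤ (D + 1 : ℕ) := by
  by_cases hl : l = []
  · have : (listTree G u).neighborSet l = ∅ := by
      ext m
      simp [listTree_adj, hl, isPathList_nil]
    simp [this]
  · have h1 : (listTree G u).neighborSet l ⊆
        insert l.dropLast ((fun x => l ++ [x]) '' G.neighborSet (l.getLast hl)) := by
      rintro m ⟨-, h2, ⟨x, rfl⟩ | ⟨x, rfl⟩⟩
      · exact Or.inr ⟨x, h2.adj_of_append (List.getLast?_eq_some_getLast hl), rfl⟩
      · left; simp
    refine (Set.encard_le_encard h1).trans ((Set.encard_insert_le _ _).trans ?_)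
    push_cast
    gcongr
    exact (Set.encard_image_le _ _).trans (hD _)

instance [hG : BoundedDegree G] (u : V) : BoundedDegree (listTree G u) := by
  obtain ⟨D, hD⟩ := hG.exists_bound
  exact ⟨D + 1, encard_neighborSet_listTree_le hD u⟩

theorem listTree_del_adj {u w : V} (hw : w ≠ u) {l m : List V} :
    (listTree (del G u) w).Adj l m ↔ (listTree G w).Adj l m ∧ u ∉ l ∧ u ∉ m := by
  rw [listTree_adj, listTree_adj, isPathList_del hw, isPathList_del hw]
  tauto

theorem nbrs_listTree_eq_empty [BoundedDegree G] {u : V} {l : List V} (h : ¬ IsPathList G u l) :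
    nbrs (listTree G u) l = ∅ := by
  ext m
  simp [listTree_adj, h]

theorem listTree_adj_singleton {u : V} {m : List V} :
    (listTree G u).Adj [u] m ↔ ∃ v, G.Adj u v ∧ m = [u, v] := by
  rw [listTree_adj]
  constructor
  · rintro ⟨-, h, ⟨x, rfl⟩ | ⟨x, hx⟩⟩
    · exact ⟨x, h.adj_of_append (by simp), rfl⟩
    · have : m = [] := by
        have := congrArg List.length hx
        simpa using this
      exact absurd (this ▸ h) (isPathList_nil u)
  · rintro ⟨v, hv, rfl⟩
    refine ⟨isPathList_singleton.2 rfl, ?_, Or.inl ⟨v, rfl⟩⟩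
    rw [isPathList_cons (by simp)]
    exact ⟨rfl, v, hv, isPathList_singleton.2 rfl⟩

/-- The self-similarity of the path tree: the branch through the edge `uv` is the path tree of `G -
u` at `v`, tied to the rest only by the edge from `[u]` to `[u, v]`. -/
theorem listTree_adj_cons {u v : V} (huv : G.Adj u v) {l m : List V}
    (hl : IsPathList (del G u) v l) :
    (listTree G u).Adj (u :: l) m ↔
      (m = [u] ∧ l = [v]) ∨ ∃ m', m = u :: m' ∧ (listTree (del G u) v).Adj l m' := by
  have hl0 : l ≠ [] := by rintro rfl; exact isPathList_nil _ hl
  have hul : IsPathList G u (u :: l) := (isPathList_cons hl0).2 ⟨rfl, v, huv, hl⟩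
  constructor
  · rintro ⟨-, h, ⟨x, rfl⟩ | ⟨x, hx⟩⟩
    · right
      refine ⟨l ++ [x], rfl, hl, ?_, Or.inl ⟨x, rfl⟩⟩
      obtain ⟨-, v', hv', h'⟩ := (isPathList_cons (l := l ++ [x]) (by simp)).1 h
      have : v' = v := by
        have := h'.append_left hl0
        exact Option.some_injective _ (this.1.symm.trans hl.1)
      rwa [this] at h'
    · cases m with
      | nil => exact absurd h (isPathList_nil u)
      | cons a m =>
        obtain rfl := h.head_eq
        have hx' : l = m ++ [x] := by simpa using hx
        by_cases hm : m = []
        · subst hm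
          left
          refine ⟨rfl, ?_⟩
          rw [hx'] at hl ⊢
          rw [List.nil_append] at hl ⊢
          rw [isPathList_singleton.1 hl]
        · right
          refine ⟨m, rfl, hl, ?_, Or.inr ⟨x, hx'⟩⟩
          rw [hx'] at hl
          exact hl.append_left hm
  · rintro (⟨rfl, rfl⟩ | ⟨m', rfl, -, h, h'⟩)
    · exact ⟨hul, isPathList_singleton.2 rfl, Or.inr ⟨v, rfl⟩⟩
    · have hm0 : m' ≠ [] := by rintro rfl; exact isPathList_nil _ h
      refine ⟨hul, (isPathList_cons hm0).2 ⟨rfl, v, huv, h⟩, ?_⟩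
      rcases h' with ⟨x, rfl⟩ | ⟨x, rfl⟩
      · exact Or.inl ⟨x, rfl⟩
      · exact Or.inr ⟨x, rfl⟩

/-- Adding a first vertex to a list. -/
def consEmb (u : V) : List V ↪ List V := ⟨List.cons u, List.cons_injective⟩

@[simp] theorem consEmb_apply (u : V) (l : List V) : consEmb u l = u :: l := rfl

/-- The lists that end in `w`. -/
def endAt (w : V) : Set (List V) := List.getLast? ⁻¹' {some w}

theorem mem_endAt {w : V} {l : List V} : l ∈ endAt w ↔ l.getLast? = some w := Iff.rfl

theorem consEmb_preimage_endAt {u w : V} (h : u ≠ w) : consEmb u ⁻¹' endAt w = endAt w := by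
  ext l
  simp only [Set.mem_preimage, mem_endAt, consEmb_apply, List.getLast?_cons]
  cases l.getLast? <;> simp [h]

theorem IsPathList.eq_of_mem_endAt {u : V} {l : List V} (h : IsPathList G u l)
    (h' : l ∈ endAt u) : l = [u] := by
  cases l with
  | nil => exact absurd h (isPathList_nil u)
  | cons a l =>
    obtain rfl := h.head_eq
    by_contra hl
    have hl0 : l ≠ [] := fun h => hl (by rw [h])
    have h3 := (List.nodup_cons.1 h.2.2).1
    rw [mem_endAt, List.getLast?_cons_of_ne_nil hl0] at h'
    exact h3 (List.mem_of_getLast? h')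

end

/-! ### Recursion for Green functions of path trees -/

section

variable {V : Type*} (G : SimpleGraph V) [BoundedDegree G]

/-- The sum over the neighbours `v` of `u` of the vectors `h v`, moved to the lists `u :: l`. -/
noncomputable def branchSum (u : V) (h : V → L2 (List V)) : L2 (List V) :=
  ∑ v ∈ nbrs G u, extendL2 (consEmb u) (h v)

/-- The vector `(z - A)⁻¹ χ_u` for the path tree of `G` at `u`. -/
noncomputable def pathGreen (z : ℂ) (u : V) : L2 (List V) := green (listTree G u) z [u]

/-- The diagonal entry of the Green function at the root of the path tree of `G` at `u`. -/
noncomputable def rootGreen (z : ℂ) (u : V) : ℂ := pathGreen G z u [u]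

variable {G}

theorem extendL2_consEmb_apply_of_ne {u : V} (f : L2 (List V)) {l : List V}
    (h : l.head? ≠ some u) : extendL2 (consEmb u) f l = 0 := by
  refine extendL2_apply_of_notMem _ _ ?_
  rintro ⟨m, rfl⟩
  simp at h

theorem branchSum_apply_cons (u : V) (h : V → L2 (List V)) (l : List V) :
    branchSum G u h (u :: l) = ∑ v ∈ nbrs G u, h v l := by
  rw [branchSum, lp.coeFn_sum, Finset.sum_apply]
  exact Finset.sum_congr rfl fun v _ => extendL2_apply (consEmb u) (h v) l

theorem branchSum_apply_of_ne {u : V} (h : V → L2 (List V)) {l : List V}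
    (hl : l.head? ≠ some u) : branchSum G u h l = 0 := by
  rw [branchSum, lp.coeFn_sum, Finset.sum_apply]
  exact Finset.sum_eq_zero fun v _ => extendL2_consEmb_apply_of_ne (h v) hl

/-- The second vertex of a path determines its branch, so the summands have disjoint supports. -/
theorem branchSum_apply_of_isPathList {u v : V} (huv : G.Adj u v) {h : V → L2 (List V)}
    (hh : ∀ v l, G.Adj u v → ¬ IsPathList (del G u) v l → h v l = 0) {l : List V}
    (hl : IsPathList (del G u) v l) : branchSum G u h (u :: l) = h v l := by
  rw [branchSum_apply_cons]
  refine Finset.sum_eq_single v (fun v' hv' hne => hh _ _ ((mem_nbrs _ _ _).1 hv') fun h' => hne ?_)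
    fun h => absurd ((mem_nbrs _ _ _).2 huv) h
  exact Option.some_injective _ (h'.1.symm.trans hl.1)

theorem sqSum_branchSum {u : V} {h : V → L2 (List V)}
    (hh : ∀ v l, G.Adj u v → ¬ IsPathList (del G u) v l → h v l = 0) (s : Set (List V)) :
    sqSum s (branchSum G u h) = ∑ v ∈ nbrs G u, sqSum (consEmb u ⁻¹' s) (h v) := by
  rw [branchSum, sqSum_sum]
  · exact Finset.sum_congr rfl fun v _ => sqSum_extendL2 _ _ _
  · intro v hv v' hv' hne l
    by_cases hl : ∃ m, consEmb u m = l
    · obtain ⟨m, rfl⟩ := hl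
      rw [extendL2_apply, extendL2_apply, mul_eq_zero]
      by_contra! hcon
      have h1 := not_imp_comm.1 (hh v m ((mem_nbrs _ _ _).1 hv)) hcon.1
      have h2 := not_imp_comm.1 (hh v' m ((mem_nbrs _ _ _).1 hv')) hcon.2
      exact hne (Option.some_injective _ (h1.1.symm.trans h2.1))
    · rw [extendL2_apply_of_notMem _ _ hl, zero_mul]

variable {z : ℂ}

theorem pathGreen_eq_zero (hz : z.im ≠ 0) {u : V} {l : List V} (h : ¬ IsPathList G u l) :
    pathGreen G z u l = 0 := by
  have h1 := green_apply (T := listTree G u) hz [u] l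
  have hz0 : z ≠ 0 := by rintro rfl; simp at hz
  rw [nbrs_listTree_eq_empty h, Finset.sum_empty, sub_zero, chi_apply_ne] at h1
  · exact (mul_eq_zero.1 h1).resolve_left hz0
  · rintro rfl
    exact h (isPathList_singleton.2 rfl)

/-- A Schur complement at the root: with the value `1` placed at `[u]`, the Green vectors of the
branches solve the homogeneous equation away from the root, and the defect at the root is `1 /
F_{G,u}`. -/
theorem branchSum_equation (hz : z.im ≠ 0) (u : V) (l : List V) :
    let g : L2 (List V) := chi [u] + branchSum G u (pathGreen (del G u) z)
    z * g l - ∑ m ∈ nbrs (listTree G u) l, g m =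
      (z - ∑ v ∈ nbrs G u, rootGreen (del G u) z v) * (chi [u] : L2 (List V)) l := by
  classical
  intro g
  have hsupp : ∀ v l, G.Adj u v → ¬ IsPathList (del G u) v l → pathGreen (del G u) z v l = 0 :=
    fun v l _ h => pathGreen_eq_zero hz h
  have hg : ∀ l, g l = (chi [u] : L2 (List V)) l + branchSum G u (pathGreen (del G u) z) l :=
    fun l => rfl
  have hgc : ∀ {v l}, G.Adj u v → IsPathList (del G u) v l →
      g (u :: l) = pathGreen (del G u) z v l := fun {v l} huv hl => by
    rw [hg, branchSum_apply_of_isPathList huv hsupp hl, chi_apply_ne, zero_add]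
    intro h
    have : l = [] := by simpa using h
    exact isPathList_nil _ (this ▸ hl)
  have hg1 : g [u] = 1 := by
    rw [hg, chi_apply_self, branchSum_apply_cons, Finset.sum_eq_zero, add_zero]
    exact fun v _ => pathGreen_eq_zero hz (isPathList_nil _)
  by_cases hl : IsPathList G u l
  · cases l with
    | nil => exact absurd hl (isPathList_nil u)
    | cons a l =>
    obtain rfl := hl.head_eq
    by_cases hl0 : l = []
    · subst hl0
      rw [hg1, chi_apply_self, mul_one, mul_one]
      congr 1
      have h1 : nbrs (listTree G a) [a] = (nbrs G a).map
          ⟨fun v => [a, v], fun v w h => by simpa using h⟩ := by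
        ext m
        simp [listTree_adj_singleton, eq_comm]
        exact Iff.rfl
      rw [h1, Finset.sum_map]
      refine Finset.sum_congr rfl fun v hv => ?_
      exact hgc ((mem_nbrs _ _ _).1 hv) (isPathList_singleton.2 rfl)
    · obtain ⟨-, v, hv, hl'⟩ := (isPathList_cons hl0).1 hl
      rw [chi_apply_ne (by simpa using hl0), mul_zero, hgc hv hl']
      have h1 : nbrs (listTree G a) (a :: l) =
          (nbrs (listTree (del G a) v) l).map (consEmb a) ∪ (if l = [v] then {[a]} else ∅) := by
        ext m
        rw [mem_nbrs, listTree_adj_cons hv hl']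
        by_cases h : l = [v] <;> simp [h, and_comm, eq_comm]
      have hdisj : Disjoint ((nbrs (listTree (del G a) v) l).map (consEmb a))
          (if l = [v] then {[a]} else ∅) := by
        split_ifs
        · rw [Finset.disjoint_singleton_right]
          simp [listTree_adj, isPathList_nil]
        · exact Finset.disjoint_empty_right _
      have h2 : ∑ m ∈ nbrs (listTree (del G a) v) l, g (consEmb a m) =
          ∑ m ∈ nbrs (listTree (del G a) v) l, pathGreen (del G a) z v m :=
        Finset.sum_congr rfl fun m hm => hgc hv ((mem_nbrs _ _ _).1 hm).2.1
      have h3 := green_apply (T := listTree (del G a) v) hz [v] l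
      rw [h1, Finset.sum_union hdisj, Finset.sum_map, h2, ← sub_sub]
      change z * pathGreen (del G a) z v l - ∑ m ∈ nbrs (listTree (del G a) v) l,
        pathGreen (del G a) z v m = _ at h3
      rw [h3]
      -- At `l = [v]` the value `1` at the root cancels the source `χ_v` of the branch; elsewhere on
      -- the branch there is no source.
      split_ifs with h
      · rw [h, chi_apply_self, Finset.sum_singleton, hg1, sub_self]
      · rw [chi_apply_ne h, Finset.sum_empty, sub_zero]
  · have h0 : l ≠ [u] := by
      rintro rfl
      exact hl (isPathList_singleton.2 rfl)
    rw [nbrs_listTree_eq_empty hl, Finset.sum_empty, chi_apply_ne h0, sub_zero, mul_zero, hg,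
      chi_apply_ne h0, zero_add]
    refine mul_eq_zero_of_right _ ?_
    cases l with
    | nil => exact branchSum_apply_of_ne _ (by simp)
    | cons a l =>
      by_cases ha : a = u
      · subst ha
        rw [branchSum_apply_cons]
        refine Finset.sum_eq_zero fun v hv => pathGreen_eq_zero hz fun h => hl ?_
        refine (isPathList_cons ?_).2 ⟨rfl, v, (mem_nbrs _ _ _).1 hv, h⟩
        rintro rfl
        exact isPathList_nil _ h
      · exact branchSum_apply_of_ne _ (by simpa using ha)

theorem sub_sum_mul_rootGreen (hz : z.im ≠ 0) (u : V) :
    (z - ∑ v ∈ nbrs G u, rootGreen (del G u) z v) * rootGreen G z u = 1 := by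
  have h := eq_smul_green hz (branchSum_equation (G := G) hz u)
  have h2 := congrArg (fun f : L2 (List V) => f [u]) h
  have h3 : branchSum G u (pathGreen (del G u) z) [u] = 0 := by
    rw [branchSum_apply_cons]
    exact Finset.sum_eq_zero fun v _ => pathGreen_eq_zero hz (isPathList_nil _)
  have h4 : (chi [u] : L2 (List V)) [u] + branchSum G u (pathGreen (del G u) z) [u] =
      (z - ∑ v ∈ nbrs G u, rootGreen (del G u) z v) * rootGreen G z u := h2
  rw [← h4, h3, chi_apply_self, add_zero]

theorem rootGreen_ne_zero (hz : z.im ≠ 0) (u : V) : rootGreen G z u ≠ 0 :=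
  right_ne_zero_of_mul_eq_one (sub_sum_mul_rootGreen hz u)

theorem inv_rootGreen (hz : z.im ≠ 0) (u : V) :
    (rootGreen G z u)⁻¹ = z - ∑ v ∈ nbrs G u, rootGreen (del G u) z v :=
  (eq_inv_of_mul_eq_one_left (sub_sum_mul_rootGreen hz u)).symm

theorem pathGreen_eq (hz : z.im ≠ 0) (u : V) :
    pathGreen G z u = rootGreen G z u • (chi [u] + branchSum G u (pathGreen (del G u) z)) := by
  rw [eq_smul_green hz (branchSum_equation (G := G) hz u), ← inv_rootGreen hz, smul_smul,
    mul_inv_cancel₀ (rootGreen_ne_zero hz u), one_smul]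
  rfl

variable (G)

/-- The sum of the squares of the Green function of the path tree of `G` at `u` over the paths
from `u` to `w`. -/
noncomputable def pathSqSum (z : ℂ) (u w : V) : ℂ := sqSum (endAt w) (pathGreen G z u)

variable {G}

theorem pathSqSum_self (hz : z.im ≠ 0) (u : V) : pathSqSum G z u u = rootGreen G z u ^ 2 := by
  refine sqSum_eq_single (by simp [mem_endAt]) fun l hl hne => pathGreen_eq_zero hz fun h => ?_
  exact hne (h.eq_of_mem_endAt hl)

theorem pathSqSum_eq_mul_sqSum_branchSum (hz : z.im ≠ 0) {u w : V} (h : u ≠ w) :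
    pathSqSum G z u w = rootGreen G z u ^ 2 *
      sqSum (endAt w) (branchSum G u (pathGreen (del G u) z)) := by
  rw [pathSqSum, pathGreen_eq hz, sqSum_smul]
  congr 1
  refine sqSum_congr fun l hl => ?_
  have : l ≠ [u] := by
    rintro rfl
    exact h (by simpa [mem_endAt] using hl)
  rw [lp.coeFn_add, Pi.add_apply, chi_apply_ne this, zero_add]

/-- Sort the paths from `u` to `w` by their first edge; the remainder is a path of `G - u`. -/
theorem pathSqSum_of_ne (hz : z.im ≠ 0) {u w : V} (h : u ≠ w) :
    pathSqSum G z u w = rootGreen G z u ^ 2 * ∑ v ∈ nbrs G u, pathSqSum (del G u) z v w := by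
  rw [pathSqSum_eq_mul_sqSum_branchSum hz h, sqSum_branchSum, consEmb_preimage_endAt h]
  · rfl
  · exact fun v l _ h => pathGreen_eq_zero hz h

end

/-! ### Identities between Green functions -/

section

variable {V : Type*} {z : ℂ}

theorem del_comm (G : SimpleGraph V) (u w : V) : del (del G u) w = del (del G w) u :=
  keep_keep_comm _ _

theorem rootGreen_congr {G H : SimpleGraph V} [BoundedDegree G] [BoundedDegree H] (h : G = H)
    (u : V) : rootGreen G z u = rootGreen H z u := by
  subst h; rfl

theorem sum_nbrs_eq_ite_add [DecidableEq V] (G : SimpleGraph V) [DecidableRel G.Adj] [BoundedDegree G]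
    (u w : V) (φ : V → ℂ) : ∑ v ∈ nbrs G u, φ v =
      (if G.Adj u w then φ w else 0) + ∑ v ∈ (nbrs G u).erase w, φ v := by
  split_ifs with h
  · exact (Finset.add_sum_erase _ _ ((mem_nbrs _ _ _).2 h)).symm
  · rw [Finset.erase_eq_of_notMem (by simpa using h), zero_add]

/-- The inductions run on the size of a set containing all non-isolated vertices, so the vertex type
stays fixed; deleting a vertex that carries an edge lowers this size. -/
theorem support_del {G : SimpleGraph V} {n : ℕ} {u v : V} (huv : G.Adj u v)
    (h : ∃ s : Finset V, s.card ≤ n + 1 ∧ ∀ a b, G.Adj a b → a ∈ s) :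
    ∃ s : Finset V, s.card ≤ n ∧ ∀ a b, (del G u).Adj a b → a ∈ s := by
  classical
  obtain ⟨s, hs, hG⟩ := h
  refine ⟨s.erase u, ?_, fun a b hab => Finset.mem_erase.2 ⟨hab.2.1, hG a b hab.1⟩⟩
  have := Finset.card_erase_of_mem (hG u v huv)
  omega

theorem support_keep {G : SimpleGraph V} {n : ℕ} (S : Set V)
    (h : ∃ s : Finset V, s.card ≤ n ∧ ∀ a b, G.Adj a b → a ∈ s) :
    ∃ s : Finset V, s.card ≤ n ∧ ∀ a b, (keep G S).Adj a b → a ∈ s := by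
  obtain ⟨s, hs, hG⟩ := h
  exact ⟨s, hs, fun a b hab => hG a b hab.1⟩

/-- The expansion of `1 / (F_{G,u} F_{G-u,w})` that is symmetric in `u` and `w`, given the
exchange relation in `G - u`. -/
theorem inv_rootGreen_mul_inv_rootGreen [DecidableEq V] (hz : z.im ≠ 0) (G : SimpleGraph V)
    [DecidableRel G.Adj] [BoundedDegree G] {u w : V} (huw : u ≠ w)
    (ih : ∀ v, G.Adj u v → v ≠ w →
      rootGreen (del G u) z v * rootGreen (del (del G u) v) z w =
        rootGreen (del G u) z w * rootGreen (del (del G u) w) z v) :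
    (rootGreen G z u)⁻¹ * (rootGreen (del G u) z w)⁻¹ =
      z * z - z * ∑ y ∈ (nbrs G w).erase u, rootGreen (del (del G u) w) z y
        - z * ∑ v ∈ (nbrs G u).erase w, rootGreen (del (del G u) w) z v
        - (if G.Adj u w then 1 else 0)
        + ∑ v ∈ (nbrs G u).erase w, ∑ y ∈ (nbrs G w).erase u, if y = v then 0 else
            rootGreen (del (del G u) w) z v * rootGreen (del (del (del G u) w) v) z y := by
  have hne := fun (H : SimpleGraph V) [BoundedDegree H] (x : V) => rootGreen_ne_zero (G := H) hz x
  -- The exchange relation in `G - u` turns `F_{G-u,v} / F_{G-u,w}` into `F_{G-u-w,v} /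
  -- F_{G-u-v,w}`, whose denominator the recursion expands. The entry `y = v` is set to `0` because
  -- `v` is already deleted there.
  have h1 : ∀ v ∈ (nbrs G u).erase w, rootGreen (del G u) z v * (rootGreen (del G u) z w)⁻¹ =
      z * rootGreen (del (del G u) w) z v -
        ∑ y ∈ (nbrs G w).erase u, if y = v then 0 else
          rootGreen (del (del G u) w) z v * rootGreen (del (del (del G u) w) v) z y := by
    intro v hv
    rw [Finset.mem_erase, mem_nbrs] at hv
    have h2 : rootGreen (del G u) z v * (rootGreen (del G u) z w)⁻¹ =
        rootGreen (del (del G u) w) z v * (rootGreen (del (del G u) v) z w)⁻¹ := by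
      have := ih v hv.2 hv.1
      field_simp [hne]
      rw [this]
    rw [h2, inv_rootGreen hz, mul_sub, mul_comm z, Finset.mul_sum]
    congr 1
    rw [nbrs_del hv.1.symm, nbrs_del huw.symm]
    refine Eq.trans (Finset.sum_congr rfl fun y hy => ?_) (Finset.sum_erase (a := v) _ (by simp))
    rw [if_neg (Finset.ne_of_mem_erase hy), rootGreen_congr (del_comm (del G u) v w)]
  rw [inv_rootGreen hz u, sub_mul, Finset.sum_mul, sum_nbrs_eq_ite_add G u w,
    Finset.sum_congr rfl h1, Finset.sum_sub_distrib, inv_rootGreen (G := del G u) hz w,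
    ← inv_rootGreen (G := del G u) hz w, mul_inv_cancel₀ (hne _ _), inv_rootGreen hz w,
    nbrs_del huw.symm, ← Finset.mul_sum]
  ring

/-- On a finite graph both sides are the ratio of the matching polynomials of `G - u - w` and `G`.
Here the inverses of both sides are expanded and the expansions agree by induction. -/
theorem rootGreen_exchange_of_finite (hz : z.im ≠ 0) (n : ℕ) : ∀ (G : SimpleGraph V)
    [BoundedDegree G], (∃ s : Finset V, s.card ≤ n ∧ ∀ a b, G.Adj a b → a ∈ s) →
    ∀ u w, u ≠ w → rootGreen G z u * rootGreen (del G u) z w =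
      rootGreen G z w * rootGreen (del G w) z u := by
  classical
  induction n with
  | zero =>
    intro G _ hG u w huw
    obtain ⟨s, hs, hG⟩ := hG
    have hno : ∀ a b, ¬ G.Adj a b := fun a b h => by
      have := hG a b h
      simp_all
    rw [← inv_inj, mul_inv, mul_inv, inv_rootGreen_mul_inv_rootGreen hz G huw
      (fun v hv => absurd hv (hno _ _)), inv_rootGreen_mul_inv_rootGreen hz G huw.symm
      (fun v hv => absurd hv (hno _ _))]
    have : ∀ a, nbrs G a = ∅ := fun a => by ext b; simp [hno]
    simp [this, hno]
  | succ n ih =>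
    intro G _ hG u w huw
    have ih1 : ∀ u w : V, ∀ v, G.Adj u v → v ≠ w →
        rootGreen (del G u) z v * rootGreen (del (del G u) v) z w =
        rootGreen (del G u) z w * rootGreen (del (del G u) w) z v :=
      fun u w v hv hvw => ih _ (support_del hv hG) v w hvw
    rw [← inv_inj, mul_inv, mul_inv, inv_rootGreen_mul_inv_rootGreen hz G huw (ih1 u w),
      inv_rootGreen_mul_inv_rootGreen hz G huw.symm (ih1 w u), Finset.sum_comm]
    have e1 : ∀ v, rootGreen (del (del G w) u) z v = rootGreen (del (del G u) w) z v :=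
      rootGreen_congr (del_comm G w u)
    have e2 : ∀ v y, rootGreen (del (del (del G w) u) v) z y =
        rootGreen (del (del (del G u) w) v) z y := fun v =>
      rootGreen_congr (by rw [del_comm G w u])
    simp_rw [e1, e2]
    -- Symmetry of the double sum, term by term, is the exchange relation in `G - u - w`; the edge
    -- `uv` ensures that deleting `u` has already lowered the support bound.
    have h2 : ∑ y ∈ (nbrs G w).erase u, ∑ v ∈ (nbrs G u).erase w, (if y = v then 0 else
            rootGreen (del (del G u) w) z v * rootGreen (del (del (del G u) w) v) z y) =
        ∑ v ∈ (nbrs G w).erase u, ∑ y ∈ (nbrs G u).erase w, (if y = v then 0 else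
            rootGreen (del (del G u) w) z v * rootGreen (del (del (del G u) w) v) z y) := by
      refine Finset.sum_congr rfl fun y hy => Finset.sum_congr rfl fun v hv => ?_
      by_cases h : y = v
      · simp [h]
      · rw [if_neg h, if_neg (Ne.symm h)]
        rw [Finset.mem_erase, mem_nbrs] at hv
        exact ih _ (support_keep _ (support_del hv.2 hG)) v y (Ne.symm h)
    rw [h2, G.adj_comm w u]
    ring

/-! ### The Christoffel–Darboux identity for finitely many edges -/

/-- Paths start at `w` and end at `u` so that the first-step recursion deletes `w` and keeps the
target `u` for the induction. -/
theorem pathSqSum_symm_of_finite (hz : z.im ≠ 0) (n : ℕ) : ∀ (G : SimpleGraph V)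
    [BoundedDegree G], (∃ s : Finset V, s.card ≤ n ∧ ∀ a b, G.Adj a b → a ∈ s) →
    ∀ u w, u ≠ w → pathSqSum G z w u =
      rootGreen G z u * (rootGreen G z w - rootGreen (del G u) z w) := by
  classical
  have hne := fun (H : SimpleGraph V) [BoundedDegree H] (x : V) => rootGreen_ne_zero (G := H) hz x
  induction n with
  | zero =>
    intro G _ hG u w huw
    obtain ⟨s, hs, hG⟩ := hG
    have hno : ∀ a b, ¬ G.Adj a b := fun a b h => by
      have := hG a b h
      simp_all
    have h1 : nbrs G w = ∅ := by ext b; simp [hno]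
    have h2 : del G u = G := by ext a b; simp [keep_adj, hno]
    rw [pathSqSum_of_ne hz huw.symm, h1]
    simp [h2]
  | succ n ih =>
    intro G _ hG u w huw
    rw [pathSqSum_of_ne hz huw.symm, sum_nbrs_eq_ite_add G w u]
    have h1 : ∑ x ∈ (nbrs G w).erase u, pathSqSum (del G w) z x u =
        rootGreen (del G w) z u * (∑ x ∈ (nbrs G w).erase u, rootGreen (del G w) z x -
          ∑ x ∈ (nbrs G w).erase u, rootGreen (del (del G w) u) z x) := by
      rw [← Finset.sum_sub_distrib, Finset.mul_sum]
      refine Finset.sum_congr rfl fun x hx => ?_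
      rw [Finset.mem_erase, mem_nbrs] at hx
      exact ih _ (support_del hx.2 hG) u x hx.1.symm
    have h2 := inv_rootGreen (G := G) hz w
    rw [sum_nbrs_eq_ite_add G w u] at h2
    have h3 := inv_rootGreen (G := del G u) hz w
    rw [nbrs_del huw.symm, Finset.sum_congr rfl
      fun x _ => rootGreen_congr (z := z) (del_comm G u w) x] at h3
    have h4 := rootGreen_exchange_of_finite hz _ G hG u w huw
    -- The inductive differences add up to a difference of two inverse Green functions; a possible
    -- edge `wu` adds `F_{G-w,u}²`, matching the extra term in `1 / F_{G,w}`.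
    have h5 : (if G.Adj w u then pathSqSum (del G w) z u u else 0) +
        ∑ x ∈ (nbrs G w).erase u, pathSqSum (del G w) z x u =
        rootGreen (del G w) z u * ((rootGreen (del G u) z w)⁻¹ - (rootGreen G z w)⁻¹) := by
      rw [h1, h2, h3, pathSqSum_self hz]
      split_ifs <;> ring
    rw [h5]
    have n1 := hne G w
    have n2 := hne (del G u) w
    field_simp
    linear_combination (rootGreen (del G u) z w - rootGreen G z w) * h4

theorem pathSqSum_of_finite (hz : z.im ≠ 0) (G : SimpleGraph V) [BoundedDegree G]
    (hG : ∃ s : Finset V, ∀ a b, G.Adj a b → a ∈ s) {u w : V} (huw : u ≠ w) :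
    pathSqSum G z u w = rootGreen G z u * (rootGreen G z w - rootGreen (del G u) z w) := by
  obtain ⟨s, hs⟩ := hG
  have h1 := pathSqSum_symm_of_finite hz s.card G ⟨s, le_rfl, hs⟩ w u huw.symm
  have h2 := rootGreen_exchange_of_finite hz s.card G ⟨s, le_rfl, hs⟩ u w huw
  rw [h1, mul_sub, mul_sub, h2, mul_comm]

end

/-! ### Passage to infinite graphs -/

section

variable {V : Type*} {z : ℂ}

/-- It is enough that `s` contains `u` and the vertices of `l` and of its finitely many neighbours.
-/
theorem eventually_listTree_keep_adj_iff (G : SimpleGraph V) [BoundedDegree G] (u : V)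
    (l : List V) : ∀ᶠ s : Finset V in atTop, ∀ m,
      (listTree (keep G (s : Set V)) u).Adj l m ↔ (listTree G u).Adj l m := by
  classical
  filter_upwards [eventually_ge_atTop
    (insert u (l.toFinset ∪ (nbrs (listTree G u) l).biUnion List.toFinset))] with s hs m
  have hu : u ∈ (s : Set V) := hs (Finset.mem_insert_self _ _)
  rw [listTree_adj, listTree_adj, isPathList_keep hu, isPathList_keep hu]
  refine ⟨fun h => ⟨h.1.1, h.2.1.1, h.2.2⟩, fun h => ⟨⟨h.1, fun x hx => hs ?_⟩,
    ⟨h.2.1, fun x hx => hs ?_⟩, h.2.2⟩⟩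
  · simp [hx]
  · have hm : m ∈ nbrs (listTree G u) l := (mem_nbrs _ _ _).2 h
    simp only [Finset.mem_insert, Finset.mem_union, Finset.mem_biUnion, List.mem_toFinset]
    exact Or.inr (Or.inr ⟨m, hm, hx⟩)

theorem tendsto_pathGreen_keep (G : SimpleGraph V) [hG : BoundedDegree G] (hz : z.im ≠ 0) (u : V) :
    Tendsto (fun s : Finset V => pathGreen (keep G (s : Set V)) z u) atTop
      (𝓝 (pathGreen G z u)) := by
  obtain ⟨D, hD⟩ := hG.exists_bound
  exact tendsto_green (D := D + 1) (fun s v => encard_neighborSet_listTree_le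
      (fun w => (encard_neighborSet_keep_le _ w).trans (hD w)) u v)
    (eventually_listTree_keep_adj_iff G u) hz [u]

theorem tendsto_apply_of_tendsto {X ι : Type*} {l : Filter ι} {f : ι → L2 X} {g : L2 X}
    (h : Tendsto f l (𝓝 g)) (x : X) : Tendsto (fun i => f i x) l (𝓝 (g x)) :=
  ((lp.evalCLM ℂ (fun _ : X => ℂ) 2 x).continuous.tendsto g).comp h

/-- The sum of the squares of the Green function over the paths from `u` to `w`, as in the
Christoffel–Darboux identity of Heilmann and Lieb. -/
theorem pathSqSum_eq (hz : z.im ≠ 0) (G : SimpleGraph V) [BoundedDegree G] {u w : V}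
    (huw : u ≠ w) :
    pathSqSum G z u w = rootGreen G z u * (rootGreen G z w - rootGreen (del G u) z w) := by
  have h1 : Tendsto (fun s : Finset V => pathSqSum (keep G (s : Set V)) z u w) atTop
      (𝓝 (pathSqSum G z u w)) :=
    ((continuous_sqSum (endAt w)).tendsto _).comp (tendsto_pathGreen_keep G hz u)
  have h2 : ∀ (H : SimpleGraph V) [BoundedDegree H] (x : V),
      Tendsto (fun s : Finset V => rootGreen (keep H (s : Set V)) z x) atTop
        (𝓝 (rootGreen H z x)) := fun H _ x =>
    tendsto_apply_of_tendsto (tendsto_pathGreen_keep H hz x) [x]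
  refine tendsto_nhds_unique h1 (((h2 G u).mul ((h2 G w).sub (h2 (del G u) w))).congr fun s => ?_)
  have h3 := pathSqSum_of_finite hz (keep G (s : Set V))
    ⟨s, fun a b (hab : (keep G (s : Set V)).Adj a b) => hab.2.1⟩ huw
  rw [h3, rootGreen_congr (keep_keep_comm {u}ᶜ (s : Set V)) w]

end

/-! ### Path trees of graphs and list trees -/

section

variable {V W : Type*} {H : SimpleGraph V} {K : SimpleGraph W}

/-- The list of the vertices of a path, mapped to another vertex set. -/
def pathToList (f : W ↪ V) (a : W) : PathsFrom K a ↪ List V where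
  toFun P := P.2.1.support.map f
  inj' := by
    rintro ⟨b, P⟩ ⟨c, Q⟩ h
    have h1 : P.1.support = Q.1.support := List.map_injective_iff.2 f.injective h
    have h2 : b = c := by
      rw [← P.1.getLast_support, ← Q.1.getLast_support]
      simp only [h1]
    subst h2
    congr 1
    exact Subtype.ext (SimpleGraph.Walk.ext_support h1)

theorem exists_walk_of_isChain (f : W ↪ V)
    (hf : ∀ a y, H.Adj (f a) y ↔ ∃ b, f b = y ∧ K.Adj a b) : ∀ (m : List V) (a : W),
    (f a :: m).IsChain H.Adj → ∃ b, ∃ p : K.Walk a b, p.support.map f = f a :: m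
  | [], a, _ => ⟨a, .nil, by simp⟩
  | y :: m, a, h => by
    rw [List.isChain_cons_cons, hf] at h
    obtain ⟨⟨b, rfl, hab⟩, h⟩ := h
    obtain ⟨c, p, hp⟩ := exists_walk_of_isChain f hf m b h
    exact ⟨c, .cons hab p, by simp [hp]⟩

theorem isPathList_iff_exists (f : W ↪ V)
    (hf : ∀ a y, H.Adj (f a) y ↔ ∃ b, f b = y ∧ K.Adj a b) (a : W) (m : List V) :
    IsPathList H (f a) m ↔ ∃ P : PathsFrom K a, pathToList f a P = m := by
  constructor
  · intro h
    cases m with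
    | nil => exact absurd h (isPathList_nil _)
    | cons y m =>
      obtain rfl := h.head_eq
      obtain ⟨b, p, hp⟩ := exists_walk_of_isChain f hf m a h.2.1
      have hn := h.2.2
      rw [← hp] at hn
      exact ⟨⟨b, p, SimpleGraph.Walk.IsPath.mk' hn.of_map⟩, hp⟩
  · rintro ⟨⟨b, p, hp⟩, rfl⟩
    refine ⟨?_, ?_, hp.support_nodup.map f.injective⟩
    · change (p.support.map f).head? = _
      rw [List.head?_map, List.head?_eq_some_head p.support_ne_nil]
      simp
    · change (p.support.map f).IsChain _
      rw [List.isChain_map]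
      exact p.isChain_adj_support.imp fun a b hab => (hf a (f b)).2 ⟨b, rfl, hab⟩

theorem isExtension_iff (f : W ↪ V) {a : W} (P Q : PathsFrom K a) :
    IsExtension P Q ↔ ∃ x, pathToList f a Q = pathToList f a P ++ [x] := by
  constructor
  · rintro ⟨h, hQ⟩
    refine ⟨f Q.1, ?_⟩
    change Q.2.1.support.map f = P.2.1.support.map f ++ [f Q.1]
    rw [hQ, SimpleGraph.Walk.support_concat]
    simp
  · rintro ⟨x, hx⟩
    obtain ⟨b, P⟩ := P
    obtain ⟨c, Q⟩ := Q
    change Q.1.support.map f = P.1.support.map f ++ [x] at hx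
    obtain ⟨l₁, l₂, hl, h1, h2⟩ := List.map_eq_append_iff.1 hx
    have h3 : l₁ = P.1.support := List.map_injective_iff.2 f.injective h1
    obtain ⟨y, rfl, -⟩ := List.map_eq_singleton_iff.1 h2
    subst h3
    have h4 : c = y := by
      have := Q.1.getLast_support
      simp only [hl] at this
      simpa using this.symm
    subst h4
    have h5 := Q.1.isChain_adj_support
    rw [hl, List.isChain_append] at h5
    have h6 : K.Adj b c := h5.2.2 b (by
      rw [List.getLast?_eq_some_getLast P.1.support_ne_nil]; simp) c rfl
    refine ⟨h6, SimpleGraph.Walk.ext_support ?_⟩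
    rw [SimpleGraph.Walk.support_concat]
    simpa using hl

/-- With `f` the identity or the inclusion of `{u}ᶜ`, the trees of `G` and of `G - u` are placed on
the same type `List V`, so their vectors can be compared. -/
theorem atomMass_eq_atomAt [BoundedDegree H] [BoundedDegree K] (f : W ↪ V)
    (hf : ∀ a y, H.Adj (f a) y ↔ ∃ b, f b = y ∧ K.Adj a b) (θ : ℝ) (a : W) :
    atomMass K θ a = atomAt (listTree H (f a)) θ [f a] := by
  refine (atomAt_embedding (pathToList f a) (fun P m => ?_) θ ⟨a, SimpleGraph.Path.nil⟩).symm
  rw [listTree_adj, isPathList_iff_exists f hf, isPathList_iff_exists f hf]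
  constructor
  · rintro ⟨-, ⟨Q, rfl⟩, h⟩
    exact ⟨Q, rfl, by rwa [← isExtension_iff, ← isExtension_iff] at h⟩
  · rintro ⟨Q, rfl, h⟩
    refine ⟨⟨P, rfl⟩, ⟨Q, rfl⟩, ?_⟩
    rwa [← isExtension_iff, ← isExtension_iff]

/-- The mass of the atom `θ` of the path tree of `G` at its root `v`. -/
noncomputable def rootAtom (G : SimpleGraph V) [BoundedDegree G] (θ : ℝ) (v : V) : ℝ :=
  atomAt (listTree G v) θ [v]

theorem atomMass_eq_rootAtom (G : SimpleGraph V) [BoundedDegree G] (θ : ℝ) (v : V) :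
    atomMass G θ v = rootAtom G θ v :=
  atomMass_eq_atomAt (Function.Embedding.refl V) (fun a y => by simp) θ v

theorem atomMassDelete_eq_rootAtom (G : SimpleGraph V) [BoundedDegree G] (θ : ℝ) {u v : V}
    (h : v ≠ u) : atomMassDelete G θ u v = rootAtom (del G u) θ v := by
  rw [atomMassDelete, dif_pos h]
  refine atomMass_eq_atomAt (Function.Embedding.subtype _) (fun a y => ?_) θ _
  constructor
  · rintro ⟨h1, -, h2⟩
    exact ⟨⟨y, h2⟩, rfl, h1⟩
  · rintro ⟨b, rfl, h⟩
    exact ⟨h, a.2, b.2⟩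

theorem atomMassDelete_self (G : SimpleGraph V) [BoundedDegree G] (θ : ℝ) (u : V) :
    atomMassDelete G θ u u = 0 := by
  simp [atomMassDelete]

end

/-! ### Atoms before and after the deletion of a vertex -/

section

variable {V : Type*} (G : SimpleGraph V) [BoundedDegree G] (θ : ℝ)

/-- The projection of `χ_u` to the eigenspace for `θ` of the path tree of `G` at `u`. -/
noncomputable def rootVec (u : V) : L2 (List V) := eigVec (listTree G u) θ [u]

variable {G θ}

theorem rootAtom_nonneg (u : V) : 0 ≤ rootAtom G θ u := atomAt_nonneg _ _

theorem rootVec_apply_root (u : V) : rootVec G θ u [u] = rootAtom G θ u := (ofReal_atomAt _ _).symm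

theorem norm_rootVec_sq (u : V) : ‖rootVec G θ u‖ ^ 2 = rootAtom G θ u :=
  (atomAt_eq_norm_sq _ _).symm

theorem tendsto_smul_pathGreen (u : V) :
    Tendsto (fun ε : ℝ => (ε * Complex.I) • pathGreen G (θ + ε * Complex.I) u) (𝓝[>] 0)
      (𝓝 (rootVec G θ u)) :=
  tendsto_smul_green θ [u]

theorem tendsto_mul_rootGreen (u : V) :
    Tendsto (fun ε : ℝ => (ε * Complex.I) * rootGreen G (θ + ε * Complex.I) u) (𝓝[>] 0)
      (𝓝 (rootAtom G θ u)) :=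
  tendsto_mul_green_self θ [u]

theorem rootVec_eq_zero {u : V} {l : List V} (h : ¬ IsPathList G u l) : rootVec G θ u l = 0 := by
  refine tendsto_nhds_unique (tendsto_apply_of_tendsto (tendsto_smul_pathGreen u) l)
    (tendsto_nhds_of_eventually_eq ?_)
  filter_upwards [self_mem_nhdsWithin] with ε hε
  rw [lp.coeFn_smul, Pi.smul_apply, pathGreen_eq_zero (im_ne_zero_of_pos hε) h, smul_zero]

theorem hasSum_sqSum_endAt {f : L2 (List V)} (h : f [] = 0) :
    HasSum (fun w => sqSum (endAt w) f) (sqSum Set.univ f) := by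
  have h1 := hasSum_sqSum_fiber List.getLast? f fun l hl => by
    rw [List.getLast?_eq_none_iff.1 hl, h]
  rwa [← (hasSum_sq f).tsum_eq, ← tsum_univ] at h1

theorem sqSum_univ_rootVec (u : V) : sqSum Set.univ (rootVec G θ u) = rootAtom G θ u := by
  rw [sqSum, tsum_univ (fun l => rootVec G θ u l ^ 2)]
  exact (hasSum_eigVec_sq θ [u]).tsum_eq

/-- The limit of `pathSqSum_eq` at `θ + iε`, scaled by `(iε)²`. -/
theorem rootAtom_mul_sub {u w : V} (h : u ≠ w) :
    (rootAtom G θ u : ℂ) * (rootAtom G θ w - rootAtom (del G u) θ w) =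
      sqSum (endAt w) (rootVec G θ u) := by
  refine tendsto_nhds_unique ((tendsto_mul_rootGreen u).mul
    ((tendsto_mul_rootGreen w).sub (tendsto_mul_rootGreen w))) ?_
  refine (((continuous_sqSum (endAt w)).tendsto _).comp (tendsto_smul_pathGreen u)).congr' ?_
  filter_upwards [self_mem_nhdsWithin] with ε hε
  have h1 := pathSqSum_eq (im_ne_zero_of_pos (θ := θ) hε) G h
  rw [pathSqSum] at h1
  rw [Function.comp_apply, sqSum_smul, h1]
  ring

/-- The sum of the vectors `rootVec_v` of `G - u` over the neighbours `v` of `u`, moved to the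
paths that start with the edge from `u` to `v`. -/
noncomputable def branchVec (G : SimpleGraph V) [BoundedDegree G] (θ : ℝ) (u : V) : L2 (List V) :=
  branchSum G u (rootVec (del G u) θ)

/-- `rootAtom_mul_sub` is empty when `a_G(u) = 0`. Dividing the Green identity by `F_{G,u}²` first
replaces the factor `F_{G,u}` by its inverse, and `iε / F_{G,u}` tends to `-∑ a_{G-u}(v)`; this sign
reverses the difference. -/
theorem sum_rootAtom_mul_sub {u w : V} (h : u ≠ w) :
    ((∑ v ∈ nbrs G u, rootAtom (del G u) θ v : ℝ) : ℂ) *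
      (rootAtom (del G u) θ w - rootAtom G θ w) = sqSum (endAt w) (branchVec G θ u) := by
  have h1 : Tendsto (fun ε : ℝ => (ε * Complex.I) • branchSum G u
      (pathGreen (del G u) (θ + ε * Complex.I))) (𝓝[>] 0) (𝓝 (branchVec G θ u)) := by
    have h2 := tendsto_finsetSum (nbrs G u) fun v _ =>
      ((extendL2 (consEmb u)).continuous.tendsto _).comp
        (tendsto_smul_pathGreen (G := del G u) (θ := θ) v)
    refine h2.congr fun ε => ?_
    simp only [Function.comp_apply, map_smul, branchSum, Finset.smul_sum]
  have h3 : Tendsto (fun ε : ℝ => (ε * Complex.I) * (θ + ε * Complex.I) - ∑ v ∈ nbrs G u,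
      (ε * Complex.I) * rootGreen (del G u) (θ + ε * Complex.I) v) (𝓝[>] 0)
      (𝓝 (0 - ∑ v ∈ nbrs G u, (rootAtom (del G u) θ v : ℂ))) := by
    refine Tendsto.sub ?_ (tendsto_finsetSum _ fun v _ => tendsto_mul_rootGreen v)
    have : Continuous fun ε : ℝ => (ε * Complex.I) * (θ + ε * Complex.I) := by fun_prop
    have h4 := this.tendsto 0
    simp only [Complex.ofReal_zero, zero_mul] at h4
    exact h4.mono_left nhdsWithin_le_nhds
  have h5 := h3.mul ((tendsto_mul_rootGreen (G := G) (θ := θ) w).sub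
    (tendsto_mul_rootGreen (G := del G u) (θ := θ) w))
  have h6 : Tendsto _ _ (𝓝 (sqSum (endAt w) (branchVec G θ u))) :=
    ((continuous_sqSum (endAt w)).tendsto _).comp h1
  have h7 := tendsto_nhds_unique (h6.congr' ?_) h5
  · rw [h7]
    push_cast
    ring
  · filter_upwards [self_mem_nhdsWithin] with ε hε
    have hz := im_ne_zero_of_pos (θ := θ) hε
    have e1 := pathSqSum_eq hz G h
    rw [pathSqSum_eq_mul_sqSum_branchSum hz h] at e1
    have e2 := sub_sum_mul_rootGreen (G := G) hz u
    have e3 := rootGreen_ne_zero (G := G) hz u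
    rw [Function.comp_apply, sqSum_smul, ← Finset.mul_sum, ← mul_sub, ← mul_sub]
    set F := rootGreen G (θ + ε * Complex.I) u
    set S := sqSum (endAt w) (branchSum G u (pathGreen (del G u) (θ + ε * Complex.I)))
    set D := rootGreen G (θ + ε * Complex.I) w - rootGreen (del G u) (θ + ε * Complex.I) w
    set Z := (θ + ε * Complex.I : ℂ) - ∑ v ∈ nbrs G u, rootGreen (del G u) (θ + ε * Complex.I) v
    -- `e1` reads `F² S = F D` and `e2` reads `Z F = 1`, so `S = Z D`.
    have e4 : F * S = D := mul_left_cancel₀ e3 (by linear_combination e1)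
    have e5 : S = Z * D := by linear_combination Z * e4 - S * e2
    rw [e5]
    ring

theorem branchVec_apply_nil (u : V) : branchVec G θ u [] = 0 :=
  branchSum_apply_of_ne _ (by simp)

theorem sqSum_univ_branchVec (u : V) : sqSum Set.univ (branchVec G θ u) =
    ((∑ v ∈ nbrs G u, rootAtom (del G u) θ v : ℝ) : ℂ) := by
  rw [branchVec, sqSum_branchSum fun v l _ h => rootVec_eq_zero h, Set.preimage_univ]
  push_cast
  exact Finset.sum_congr rfl fun v _ => sqSum_univ_rootVec v

/-- No path of `G - u` comes back to `u`. -/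
theorem sqSum_endAt_self_branchVec (u : V) : sqSum (endAt u) (branchVec G θ u) = 0 := by
  rw [branchVec, sqSum_branchSum fun v l _ h => rootVec_eq_zero h]
  refine Finset.sum_eq_zero fun v hv => sqSum_eq_zero fun l hl => rootVec_eq_zero fun h => ?_
  have hvu : v ≠ u := ((mem_nbrs _ _ _).1 hv).ne'
  have h1 := ((isPathList_del hvu).1 h).2
  have h0 : l ≠ [] := by rintro rfl; exact isPathList_nil _ h
  rw [Set.mem_preimage, mem_endAt, consEmb_apply, List.getLast?_cons_of_ne_nil h0] at hl
  exact h1 (List.mem_of_getLast? hl)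

theorem sqSum_endAt_self_rootVec (u : V) :
    sqSum (endAt u) (rootVec G θ u) = (rootAtom G θ u : ℂ) ^ 2 := by
  rw [← rootVec_apply_root]
  refine sqSum_eq_single (by simp [mem_endAt]) fun l hl hne => rootVec_eq_zero fun h => ?_
  exact hne (h.eq_of_mem_endAt hl)

/-! ### Comparison of atoms by cutting and extending eigenvectors -/

/-- With `a_G(u) = 0`, `rootAtom_mul_sub` equates a sum of squares with `-a_G(w) a_{G-w}(u) ≤ 0`, so
every square vanishes. -/
theorem rootVec_eq_zero_of_mem_endAt {u w : V} (hw : 0 < rootAtom G θ w)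
    (hu : rootAtom G θ u = 0) {l : List V} (hl : l ∈ endAt u) : rootVec G θ w l = 0 := by
  have hwu : w ≠ u := by
    rintro rfl
    exact hw.ne' hu
  have h1 := rootAtom_mul_sub (G := G) (θ := θ) hwu
  rw [hu, rootVec, sqSum_eigVec] at h1
  have h2 : rootAtom G θ w * (0 - rootAtom (del G w) θ u) =
      ∑' x : endAt u, ‖eigVec (listTree G w) θ [w] x‖ ^ 2 := by exact_mod_cast h1
  have hs : Summable fun x : endAt u => ‖eigVec (listTree G w) θ [w] x‖ ^ 2 :=
    (hasSum_norm_sq (eigVec (listTree G w) θ [w])).summable.subtype (endAt u)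
  have h3 : ‖eigVec (listTree G w) θ [w] l‖ ^ 2 ≤
      ∑' x : endAt u, ‖eigVec (listTree G w) θ [w] x‖ ^ 2 :=
    hs.le_tsum ⟨l, hl⟩ fun _ _ => by positivity
  have h4 : ‖eigVec (listTree G w) θ [w] l‖ ^ 2 ≤ 0 := by
    have := mul_nonneg hw.le (rootAtom_nonneg (G := del G w) (θ := θ) u)
    linarith
  exact norm_eq_zero.1 (pow_eq_zero_iff two_ne_zero |>.1 (le_antisymm h4 (by positivity)))

theorem norm_restrictL2_le {X : Type*} (s : Set X) (f : L2 X) : ‖restrictL2 s f‖ ≤ ‖f‖ := by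
  have := (restrictL2 s).le_of_opNorm_le (LinearMap.mkContinuous_norm_le _ zero_le_one _) f
  rwa [one_mul] at this

/-- Testing the atom of `G'` against the eigenvector `f` gives `a² ≤ a a'`, where `a` and `a'` are
the two atoms. -/
theorem le_rootAtom {G' : SimpleGraph V} [BoundedDegree G'] {w : V} {f : L2 (List V)}
    (h1 : f [w] = rootAtom G θ w) (h2 : ‖f‖ ^ 2 ≤ rootAtom G θ w) (h0 : 0 < rootAtom G θ w)
    (h : ∀ l, ∑ m ∈ nbrs (listTree G' w) l, f m = θ * f l) :
    rootAtom G θ w ≤ rootAtom G' θ w := by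
  have h3 := norm_sq_le_mul_atomAt h [w]
  rw [h1, Complex.norm_real, Real.norm_eq_abs, sq_abs, sq] at h3
  refine le_of_mul_le_mul_left (h3.trans ?_) h0
  exact mul_le_mul_of_nonneg_right h2 (rootAtom_nonneg _)

/-- Cut the eigenvector to the paths avoiding `u`. It vanishes on the paths ending at `u`, which are
the only edges out of that region, so the cut vector is an eigenvector for `G - u`. -/
theorem rootAtom_le_rootAtom_del {u w : V} (hw : w ≠ u) (hu : rootAtom G θ u = 0) :
    rootAtom G θ w ≤ rootAtom (del G u) θ w := by
  rcases (rootAtom_nonneg (G := G) (θ := θ) w).eq_or_lt with h0 | h0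
  · rw [← h0]; exact rootAtom_nonneg _
  let s : Set (List V) := {l | u ∉ l}
  let f : L2 (List V) :=
    extendL2 (Function.Embedding.subtype (· ∈ s)) (restrictL2 s (rootVec G θ w))
  have hfs : ∀ l, u ∉ l → f l = rootVec G θ w l := fun l hl =>
    extendL2_apply (Function.Embedding.subtype (· ∈ s)) (restrictL2 s (rootVec G θ w)) ⟨l, hl⟩
  have hf0 : ∀ l, u ∈ l → f l = 0 := fun l hl => by
    refine extendL2_apply_of_notMem _ _ ?_
    rintro ⟨x, rfl⟩
    exact x.2 hl
  refine le_rootAtom (f := f) ?_ ?_ h0 fun l => ?_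
  · rw [hfs _ (by simpa using hw.symm), rootVec_apply_root]
  · rw [← norm_rootVec_sq]
    gcongr
    rw [LinearIsometry.norm_map]
    exact norm_restrictL2_le _ _
  · by_cases hl : IsPathList (del G u) w l
    · have hul := ((isPathList_del hw).1 hl).2
      rw [hfs l hul, rootVec, ← sum_nbrs_eigVec]
      refine Eq.trans (Finset.sum_congr rfl fun m hm => hfs m
        ((listTree_del_adj hw).1 ((mem_nbrs _ _ _).1 hm)).2.2) (Finset.sum_subset ?_ ?_)
      · intro m hm
        rw [mem_nbrs] at hm ⊢
        exact ((listTree_del_adj hw).1 hm).1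
      · intro m hm hm'
        rw [mem_nbrs] at hm hm'
        -- A neighbour lost in `G - u` contains `u` while `l` does not, so it prolongs `l` by `u`.
        have hum : u ∈ m := by
          by_contra hum
          exact hm' ((listTree_del_adj hw).2 ⟨hm, hul, hum⟩)
        refine rootVec_eq_zero_of_mem_endAt h0 hu ?_
        rcases hm.2.2 with ⟨x, rfl⟩ | ⟨x, rfl⟩
        · have : u = x := by simpa [hul] using hum
          simp [mem_endAt, this]
        · exact absurd (List.mem_append_left _ hum) hul
    · rw [nbrs_listTree_eq_empty hl, Finset.sum_empty]
      by_cases hul : u ∈ l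
      · rw [hf0 l hul, mul_zero]
      · rw [hfs l hul, rootVec_eq_zero fun h => hl ((isPathList_del hw).2 ⟨h, hul⟩), mul_zero]

/-- Extend the eigenvector of `G - u` by zero. The equation could fail only at a path ending at `u`;
its predecessor ends at a neighbour of `u`, where the vector vanishes. -/
theorem rootAtom_del_le_rootAtom {u w : V} (hw : w ≠ u)
    (hu : ∀ v, G.Adj u v → rootAtom (del G u) θ v = 0) :
    rootAtom (del G u) θ w ≤ rootAtom G θ w := by
  rcases (rootAtom_nonneg (G := del G u) (θ := θ) w).eq_or_lt with h0 | h0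
  · rw [← h0]; exact rootAtom_nonneg _
  refine le_rootAtom (f := rootVec (del G u) θ w) (rootVec_apply_root w) (norm_rootVec_sq w).le h0
    fun l => ?_
  by_cases hl : IsPathList (del G u) w l
  · have hul := ((isPathList_del hw).1 hl).2
    rw [rootVec, ← sum_nbrs_eigVec]
    refine (Finset.sum_subset ?_ ?_).symm
    · intro m hm
      rw [mem_nbrs] at hm ⊢
      exact ((listTree_del_adj hw).1 hm).1
    · intro m hm hm'
      rw [mem_nbrs] at hm hm'
      refine rootVec_eq_zero fun h => hm' ((listTree_del_adj hw).2 ⟨hm, hul, ?_⟩)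
      exact ((isPathList_del hw).1 h).2
  · rw [rootVec_eq_zero hl, mul_zero]
    refine Finset.sum_eq_zero fun m hm => ?_
    rw [mem_nbrs] at hm
    by_contra hne
    have hm' : IsPathList (del G u) w m := not_imp_comm.1 rootVec_eq_zero hne
    have hum := ((isPathList_del hw).1 hm').2
    have hul : u ∈ l := by
      by_contra hul
      exact hl ((isPathList_del hw).2 ⟨hm.1, hul⟩)
    rcases hm.2.2 with ⟨x, rfl⟩ | ⟨x, rfl⟩
    · exact hum (List.mem_append_left _ hul)
    · have hux : u = x := by simpa [hum] using hul
      subst hux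
      have hm0 : m ≠ [] := by rintro rfl; exact isPathList_nil _ hm'
      have hlast := List.getLast?_eq_some_getLast hm0
      have hadj := hm.1.adj_of_append hlast
      exact hne (rootVec_eq_zero_of_mem_endAt h0 (hu _ hadj.symm) hlast)

/-! ### The three cases -/

theorem hasSum_of_isEssential {u : V} (h : 0 < rootAtom G θ u) :
    HasSum (fun v => atomMassDelete G θ u v - atomMass G θ v) (-1) := by
  have h0 : (rootAtom G θ u : ℂ) ≠ 0 := by exact_mod_cast h.ne'
  have h1 := (hasSum_sqSum_endAt (f := rootVec G θ u)
    (rootVec_eq_zero (isPathList_nil u))).mul_left (-(rootAtom G θ u : ℂ)⁻¹)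
  rw [sqSum_univ_rootVec, neg_mul, inv_mul_cancel₀ h0] at h1
  rw [← Complex.hasSum_ofReal]
  push_cast
  refine h1.congr_fun fun v => ?_
  by_cases hv : v = u
  · subst hv
    -- The only path from `u` to `u` is trivial, with mass `a_G(u)²`; after division this is the
    -- term `0 - a_G(u)` of the convention.
    rw [atomMassDelete_self, atomMass_eq_rootAtom, sqSum_endAt_self_rootVec]
    field_simp
    simp
  · rw [atomMassDelete_eq_rootAtom G θ hv, atomMass_eq_rootAtom,
      ← rootAtom_mul_sub (Ne.symm hv)]
    field_simp
    ring

theorem hasSum_of_isPositive {u : V} (h : 0 < ∑ v ∈ nbrs G u, rootAtom (del G u) θ v) :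
    HasSum (fun v : {v : V // v ≠ u} => atomMassDelete G θ u v - atomMass G θ v) 1 := by
  have h0 : ((∑ v ∈ nbrs G u, rootAtom (del G u) θ v : ℝ) : ℂ) ≠ 0 := by exact_mod_cast h.ne'
  have h1 := (hasSum_sqSum_endAt (branchVec_apply_nil (G := G) (θ := θ) u)).mul_left
    (((∑ v ∈ nbrs G u, rootAtom (del G u) θ v : ℝ) : ℂ)⁻¹)
  rw [sqSum_univ_branchVec, inv_mul_cancel₀ h0] at h1
  -- The paths ending at `u` carry no mass, so the index `u` may be dropped.
  have h2 := (hasSum_subtype_iff_of_support_subset (s := {v : V | v ≠ u}) fun v hv => by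
    rintro rfl
    simp [sqSum_endAt_self_branchVec] at hv).2 h1
  rw [← Complex.hasSum_ofReal]
  push_cast
  refine h2.congr_fun fun v => ?_
  rw [atomMassDelete_eq_rootAtom G θ v.2, atomMass_eq_rootAtom, Function.comp_apply,
    ← sum_rootAtom_mul_sub (Ne.symm v.2), inv_mul_cancel_left₀ h0]

theorem hasSum_of_isNeutral {u : V} (h : rootAtom G θ u = 0)
    (h' : ∀ v, G.Adj u v → rootAtom (del G u) θ v = 0) :
    HasSum (fun v : {v : V // v ≠ u} => atomMassDelete G θ u v - atomMass G θ v) 0 := by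
  refine hasSum_zero.congr_fun fun v => ?_
  rw [atomMassDelete_eq_rootAtom G θ v.2, atomMass_eq_rootAtom, sub_eq_zero]
  exact le_antisymm (rootAtom_del_le_rootAtom v.2 h') (rootAtom_le_rootAtom_del v.2 h)

theorem sum_atomMassDelete_nbrs (u : V) :
    ∑ v ∈ nbrs G u, atomMassDelete G θ u v = ∑ v ∈ nbrs G u, rootAtom (del G u) θ v :=
  Finset.sum_congr rfl fun _ hv => atomMassDelete_eq_rootAtom G θ ((mem_nbrs _ _ _).1 hv).ne'

end
end MatchingMeasure

theorem mainTheorem12 {V : Type*} (G : SimpleGraph V) [MatchingMeasure.BoundedDegree G]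
    (θ : ℝ) (u : V) :
    (MatchingMeasure.IsPositive G θ u →
      HasSum (fun v : {v : V // v ≠ u} =>
        MatchingMeasure.atomMassDelete G θ u v - MatchingMeasure.atomMass G θ v) 1) ∧
    (MatchingMeasure.IsNeutral G θ u →
      HasSum (fun v : {v : V // v ≠ u} =>
        MatchingMeasure.atomMassDelete G θ u v - MatchingMeasure.atomMass G θ v) 0) ∧
    (MatchingMeasure.IsEssential G θ u →
      HasSum (fun v : V =>
        MatchingMeasure.atomMassDelete G θ u v - MatchingMeasure.atomMass G θ v) (-1)) := by
  refine ⟨fun h => ?_, fun h => ?_, fun h => ?_⟩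
  · rw [MatchingMeasure.IsPositive, MatchingMeasure.sum_atomMassDelete_nbrs] at h
    exact MatchingMeasure.hasSum_of_isPositive h
  · obtain ⟨h1, h2⟩ := h
    rw [MatchingMeasure.IsEssential, MatchingMeasure.atomMass_eq_rootAtom, not_lt] at h1
    rw [MatchingMeasure.sum_atomMassDelete_nbrs,
      Finset.sum_eq_zero_iff_of_nonneg fun v _ => MatchingMeasure.rootAtom_nonneg v] at h2
    exact MatchingMeasure.hasSum_of_isNeutral
      (le_antisymm h1 (MatchingMeasure.rootAtom_nonneg u))
      fun v hv => h2 v ((MatchingMeasure.mem_nbrs _ _ _).2 hv)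
  · rw [MatchingMeasure.IsEssential, MatchingMeasure.atomMass_eq_rootAtom] at h
    exact MatchingMeasure.hasSum_of_isEssential h
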